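/- Let $n \ge 0$, let $\mathcal S(n)$ be the space of real symmetric $n\times n$ matrices and let $\mathcal J^2 := \mathbb R\times\mathbb R^n\times\mathcal S(n)$ be the space of $2$-jets. A \emph{constant coefficient subequation} is a set $\mathcal F\subset\mathcal J^2$ with $\mathcal F\neq\emptyset$, $\mathcal F\neq\mathcal J^2$, such that for all $(r,p,A)\in\mathcal F$ - (P) $(r,p,A+P)\in\mathcal F$ for every positive definite $P\in\mathcal S(n)$; - (N) $(r+s,p,A)\in\mathcal F$ for every $s<0$; and such that - (T) $\mathcal F=\overline{\operatorname{int}\mathcal F}$. For an open set $X\subset\mathbb R^n$, let $\mathrm{USC}(X)$ be the set of upper semicontinuous functions $u: X\to[-\infty,+\infty)$. For a set $\mathcal F\subset\mathcal J^2$, let $\mathcal F(X)$ be the set of $\mathcal F$-subharmonic functions on $X$: those $u\in\mathrm{USC}(X)$ such that, for every $x\in X$ and every function $\varphi$ which is $C^2$ near $x$ and satisfies $u\le\varphi$ near $x$ and $u(x)=\varphi(x)$, one has $(\varphi(x),D\varphi(x),D^2\varphi(x))\in\mathcal F$. **Corollary (Subharmonic addition for constant coefficient subequations).** Let $\mathcal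 F,\mathcal G\subset\mathcal J^2$ be constant coefficient subequations and let $\mathcal H\subset\mathcal J^2$ be a closed set (for instance, a constant coefficient subequation). Then, for every open set $X\subset\mathbb R^n$, jet addition implies subharmonic addition; that is, $$\mathcal F+\mathcal G\subset\mathcal H \implies \mathcal F(X)+\mathcal G(X)\subset\mathcal H(X),$$ where $\mathcal F+\mathcal G=\{J+J' : J\in\mathcal F,\ J'\in\mathcal G\}$, and $\mathcal F(X)+\mathcal G(X)$ consists of the pointwise sums $u+v$ (equal to $-\infty$ wherever $u$ or $v$ is $-\infty$) with $u\in\mathcal F(X)$, $v\in\mathcal G(X)$. -/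

import Mathlib

open scoped Pointwise Topology

noncomputable section

namespace PotentialTheory

/-- The space `𝒮(n)` of real symmetric `n × n` matrices, with its usual topology. -/
abbrev SymMat (n : ℕ) : Type := selfAdjoint (Matrix (Fin n) (Fin n) ℝ)

/-- The space of `2`-jets `𝒥² = ℝ × ℝⁿ × 𝒮(n)`. -/
abbrev Jet2 (n : ℕ) : Type := ℝ × EuclideanSpace ℝ (Fin n) × SymMat n

/-- A constant coefficient subequation on `ℝⁿ`, identified with its (constant) fiber in `𝒥²`. -/
structure IsConstCoeffSubequation {n : ℕ} (F : Set (Jet2 n)) : Prop where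
  nonempty : F.Nonempty
  ne_univ : F ≠ Set.univ
  positivity : ∀ (r : ℝ) (p : EuclideanSpace ℝ (Fin n)) (A P : SymMat n),
    (r, p, A) ∈ F → (P : Matrix (Fin n) (Fin n) ℝ).PosDef → (r, p, A + P) ∈ F
  negativity : ∀ (r : ℝ) (p : EuclideanSpace ℝ (Fin n)) (A : SymMat n) (s : ℝ),
    (r, p, A) ∈ F → s < 0 → (r + s, p, A) ∈ F
  topological : F = closure (interior F)

/-- The matrix `(∂²φ/∂xᵢ∂xⱼ)(x)` of second partial derivatives. -/
def hessian {n : ℕ} (φ : EuclideanSpace ℝ (Fin n) → ℝ) (x : EuclideanSpace ℝ (Fin n)) :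
    Matrix (Fin n) (Fin n) ℝ :=
  Matrix.of fun i j => fderiv ℝ (fderiv ℝ φ) x (EuclideanSpace.single i 1)
    (EuclideanSpace.single j 1)

theorem hessian_mem_selfAdjoint {n : ℕ} {φ : EuclideanSpace ℝ (Fin n) → ℝ}
    {x : EuclideanSpace ℝ (Fin n)} (hφ : ContDiffAt ℝ 2 φ x) :
    hessian φ x ∈ selfAdjoint (Matrix (Fin n) (Fin n) ℝ) := by
  have h : IsSymmSndFDerivAt ℝ φ x := hφ.isSymmSndFDerivAt (by simp)
  rw [selfAdjoint.mem_iff]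
  ext i j
  simpa [hessian, Matrix.star_apply] using h.eq _ _

/-- The `2`-jet `J²ₓφ = (φ(x), Dφ(x), D²φ(x))` of a function which is `C²` near `x`. -/
def jet2 {n : ℕ} (φ : EuclideanSpace ℝ (Fin n) → ℝ) (x : EuclideanSpace ℝ (Fin n))
    (hφ : ContDiffAt ℝ 2 φ x) : Jet2 n :=
  (φ x, gradient φ x, ⟨hessian φ x, hessian_mem_selfAdjoint hφ⟩)

/-- `u ∈ USC(X)`: `u` is upper semicontinuous on `X` with values in `[-∞, +∞)`.
Only the values of `u` on `X` matter. -/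
def IsUSC {n : ℕ} (X : Set (EuclideanSpace ℝ (Fin n)))
    (u : EuclideanSpace ℝ (Fin n) → EReal) : Prop :=
  UpperSemicontinuousOn u X ∧ ∀ x ∈ X, u x ≠ ⊤

/-- `u` is `F`-subharmonic at `x`: the `2`-jet at `x` of every `C²` upper test function for `u`
at `x` lies in `F`. (If `u x = -∞` there are no test functions and the condition is void.) -/
def IsSubharmonicAt {n : ℕ} (F : Set (Jet2 n)) (u : EuclideanSpace ℝ (Fin n) → EReal)
    (x : EuclideanSpace ℝ (Fin n)) : Prop :=
  ∀ (φ : EuclideanSpace ℝ (Fin n) → ℝ) (hφ : ContDiffAt ℝ 2 φ x),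
    (∀ᶠ y in 𝓝 x, u y ≤ (φ y : EReal)) → u x = (φ x : EReal) → jet2 φ x hφ ∈ F

/-- The space `F(X)` of `F`-subharmonic functions on an open set `X`. -/
def subharmonics {n : ℕ} (F : Set (Jet2 n)) (X : Set (EuclideanSpace ℝ (Fin n))) :
    Set (EuclideanSpace ℝ (Fin n) → EReal) :=
  {u | IsUSC X u ∧ ∀ x ∈ X, IsSubharmonicAt F u x}

end PotentialTheory

end

/-! Let a C² function φ touch u + v from above at x₀. Neither u nor v need have a test function at
x₀, so the jet of φ is reached as a limit of sums of jets of u and v at nearby points. This is a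
theorem on sums (`exists_hasUpperJet_of_add_le_quadPoly`). With L the Hessian of φ at x₀, it yields
jets at points near x₀ whose values and gradients almost add up to those of φ and whose Hessians
satisfy A₁ + A₂ ≤ L + 4εI. Positivity of F raises A₁ until the sum is exactly L + 5εI. The summed
jet then lies in F + G ⊆ H, and closedness of H allows ε → 0.

For the theorem on sums, variables are doubled with penalty T‖x - y‖², and u, v are replaced by
Lasry–Lions envelopes. These have Lipschitz gradients (`exists_lipschitz_gradient_envelope`) and
still lie below the penalized quadratic (`envelope_add_envelope_le`). A Sard-type argument supplies
second derivatives at the contact point: by Rademacher, a Lipschitz gradient map is differentiable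
off a null set, and the image of that set is null, so for some small linear tilt every contact point
is a point of second order differentiability. Moving both variables together removes the penalty and
gives the Hessian inequality; translation then carries the jets back to u and v. -/

namespace PotentialTheory

/-! ### Lasry–Lions regularization -/

section Envelope

variable {E : Type*} [NormedAddCommGroup E]

/-- The sup-convolution `z ↦ sup {u a - t ‖a - z‖² : a ∈ B}`. -/
noncomputable def supConv (B : Set E) (u : E → ℝ) (t : ℝ) (z : E) : ℝ :=
  ⨆ a : B, (u a - t * ‖(a : E) - z‖ ^ 2)

/-- The Lasry–Lions regularization of `u` on `B`: an inf-convolution of a sup-convolution. -/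
noncomputable def envelope (B : Set E) (u : E → ℝ) (t : ℝ) (x : E) : ℝ :=
  ⨅ z, (supConv B u t z + 2 * t * ‖x - z‖ ^ 2)

variable {B : Set E} {u v : E → ℝ} {t : ℝ}

theorem bddAbove_supConv (hu : BddAbove (u '' B)) (ht : 0 < t) (z : E) :
    BddAbove (Set.range fun a : B => u a - t * ‖(a : E) - z‖ ^ 2) := by
  obtain ⟨C, hC⟩ := hu
  refine ⟨C, ?_⟩
  rintro _ ⟨a, rfl⟩
  have h1 : u a ≤ C := hC ⟨a, a.2, rfl⟩
  have h2 : 0 ≤ t * ‖(a : E) - z‖ ^ 2 := by positivity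
  simp only
  linarith

theorem le_supConv (hu : BddAbove (u '' B)) (ht : 0 < t) {a : E} (ha : a ∈ B) (z : E) :
    u a - t * ‖a - z‖ ^ 2 ≤ supConv B u t z :=
  le_ciSup (bddAbove_supConv hu ht z) (⟨a, ha⟩ : B)

variable [InnerProductSpace ℝ E]

theorem norm_sub_sq_le_two_mul (a x z : E) :
    ‖a - z‖ ^ 2 ≤ 2 * ‖x - a‖ ^ 2 + 2 * ‖x - z‖ ^ 2 := by
  have h := parallelogram_law_with_norm ℝ (x - z) (x - a)
  have h2 : x - z - (x - a) = a - z := by abel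
  rw [h2] at h
  nlinarith [mul_self_nonneg ‖x - z + (x - a)‖]

theorem norm_sub_lineMap_sq (a z z' : E) (s : ℝ) :
    ‖a - (z + s • (z' - z))‖ ^ 2 =
      (1 - s) * ‖a - z‖ ^ 2 + s * ‖a - z'‖ ^ 2 - s * (1 - s) * ‖z' - z‖ ^ 2 := by
  have h1 : a - (z + s • (z' - z)) = (a - z) - s • (z' - z) := by abel
  have h2 : a - z' = (a - z) - (z' - z) := by abel
  rw [h1, h2]
  generalize a - z = w
  rw [norm_sub_sq_real, norm_sub_sq_real, inner_smul_right, norm_smul, mul_pow,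
    Real.norm_eq_abs, sq_abs]
  ring

/-- Semiconvexity: after adding t‖z‖² every competitor is affine in z, so the supremum becomes
convex. -/
theorem supConv_lineMap_le (hB : B.Nonempty) (hu : BddAbove (u '' B)) (ht : 0 < t)
    (z z' : E) {s : ℝ} (hs0 : 0 ≤ s) (hs1 : s ≤ 1) :
    supConv B u t (z + s • (z' - z)) ≤
      (1 - s) * supConv B u t z + s * supConv B u t z' + t * (s * (1 - s)) * ‖z' - z‖ ^ 2 := by
  have : Nonempty B := hB.to_subtype
  refine ciSup_le fun a => ?_
  rw [norm_sub_lineMap_sq]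
  have h1 := mul_le_mul_of_nonneg_left (le_supConv hu ht a.2 z) (sub_nonneg.2 hs1)
  have h2 := mul_le_mul_of_nonneg_left (le_supConv hu ht a.2 z') hs0
  linarith

theorem sub_le_supConv_add (hu : BddAbove (u '' B)) (ht : 0 < t) {a : E} (ha : a ∈ B)
    (x z : E) : u a - 2 * t * ‖x - a‖ ^ 2 ≤ supConv B u t z + 2 * t * ‖x - z‖ ^ 2 := by
  have h1 := le_supConv hu ht ha z
  have h2 := mul_le_mul_of_nonneg_left (norm_sub_sq_le_two_mul a x z) ht.le
  linarith

theorem bddBelow_envelope (hB : B.Nonempty) (hu : BddAbove (u '' B)) (ht : 0 < t) (x : E) :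
    BddBelow (Set.range fun z => supConv B u t z + 2 * t * ‖x - z‖ ^ 2) := by
  obtain ⟨a, ha⟩ := hB
  refine ⟨u a - 2 * t * ‖x - a‖ ^ 2, ?_⟩
  rintro _ ⟨z, rfl⟩
  exact sub_le_supConv_add hu ht ha x z

theorem sub_le_envelope (hu : BddAbove (u '' B)) (ht : 0 < t) {a : E} (ha : a ∈ B) (x : E) :
    u a - 2 * t * ‖x - a‖ ^ 2 ≤ envelope B u t x :=
  le_ciInf fun z => sub_le_supConv_add hu ht ha x z

theorem envelope_le (hB : B.Nonempty) (hu : BddAbove (u '' B)) (ht : 0 < t) (x z : E) :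
    envelope B u t x ≤ supConv B u t z + 2 * t * ‖x - z‖ ^ 2 :=
  ciInf_le (bddBelow_envelope hB hu ht x) z

/-- A pair of envelopes stays below every function on `E × E` that dominates the sup-convolutions
and has, at the given point, a tangent paraboloid of opening `4t` from above. -/
theorem envelope_add_envelope_le (hB : B.Nonempty) (hu : BddAbove (u '' B))
    (hv : BddAbove (v '' B)) (ht : 0 < t) {Ψ : E → E → ℝ}
    (h : ∀ a ∈ B, ∀ b ∈ B, ∀ x y,
      u a - 2 * t * ‖x - a‖ ^ 2 + (v b - 2 * t * ‖y - b‖ ^ 2) ≤ Ψ x y)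
    {x₀ y₀ d e : E} (hΨ : ∀ x y, Ψ x y ≤ Ψ x₀ y₀ + inner ℝ d (x - x₀) + inner ℝ e (y - y₀) +
      2 * t * (‖x - x₀‖ ^ 2 + ‖y - y₀‖ ^ 2)) :
    envelope B u t x₀ + envelope B v t y₀ ≤ Ψ x₀ y₀ := by
  have : Nonempty B := hB.to_subtype
  have t0 : t ≠ 0 := ht.ne'
  have key : ∀ d a x₀ : E, ∃ x, inner ℝ d (x - x₀) + 2 * t * ‖x - x₀‖ ^ 2 + 2 * t * ‖x - a‖ ^ 2 =
      t * ‖a - (x₀ - (1 / (4 * t)) • d)‖ ^ 2 - ‖d‖ ^ 2 / (8 * t) := by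
    intro d a x₀
    -- The minimizer in x of the left-hand side: the midpoint of a and the shifted center x₀ -
    -- d/(4t).
    refine ⟨(1 / 2 : ℝ) • (a + (x₀ - (1 / (4 * t)) • d)), ?_⟩
    have e1 : (1 / 2 : ℝ) • (a + (x₀ - (1 / (4 * t)) • d)) - x₀ =
        (1 / 2 : ℝ) • ((a - x₀) - (1 / (4 * t)) • d) := by module
    have e2 : (1 / 2 : ℝ) • (a + (x₀ - (1 / (4 * t)) • d)) - a =
        (-1 / 2 : ℝ) • ((a - x₀) + (1 / (4 * t)) • d) := by module
    have e3 : a - (x₀ - (1 / (4 * t)) • d) = (a - x₀) + (1 / (4 * t)) • d := by module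
    rw [e1, e2, e3]
    generalize a - x₀ = w
    simp only [norm_smul, mul_pow, norm_sub_sq_real, norm_add_sq_real, inner_smul_right,
      inner_sub_right, real_inner_self_eq_norm_sq, Real.norm_eq_abs, sq_abs, real_inner_comm w d]
    field_simp
    ring
  have hsum : supConv B u t (x₀ - (1 / (4 * t)) • d) + supConv B v t (y₀ - (1 / (4 * t)) • e) ≤
      Ψ x₀ y₀ - ‖d‖ ^ 2 / (8 * t) - ‖e‖ ^ 2 / (8 * t) := by
    rw [← le_sub_iff_add_le]
    refine ciSup_le fun a => ?_
    rw [le_sub_comm]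
    refine ciSup_le fun b => ?_
    obtain ⟨x, hx⟩ := key d a x₀
    obtain ⟨y, hy⟩ := key e b y₀
    have h1 := h a a.2 b b.2 x y
    have h2 := hΨ x y
    linarith
  have n1 : ∀ d x₀ : E, 2 * t * ‖x₀ - (x₀ - (1 / (4 * t)) • d)‖ ^ 2 = ‖d‖ ^ 2 / (8 * t) := by
    intro d x₀
    rw [sub_sub_cancel, norm_smul, mul_pow, Real.norm_eq_abs, sq_abs]
    field_simp
    ring
  -- Using the shifted center as competitor in the infimum costs ‖d‖²/(8t), exactly the gain
  -- recorded in `hsum`.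
  have h1 := envelope_le hB hu ht x₀ (x₀ - (1 / (4 * t)) • d)
  have h2 := envelope_le hB hv ht y₀ (y₀ - (1 / (4 * t)) • e)
  rw [n1] at h1 h2
  linarith

/-- The convexity 2t of the outer paraboloid beats the defect t of the sup-convolution, leaving
strong convexity t. Minimality is tested on the segment towards w, divided by s, and s → 0. -/
theorem add_mul_norm_sq_le_of_isMin (hB : B.Nonempty) (hu : BddAbove (u '' B)) (ht : 0 < t)
    {x z : E} (hz : ∀ w, supConv B u t z + 2 * t * ‖x - z‖ ^ 2 ≤
      supConv B u t w + 2 * t * ‖x - w‖ ^ 2) (w : E) :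
    supConv B u t z + 2 * t * ‖x - z‖ ^ 2 + t * ‖w - z‖ ^ 2 ≤
      supConv B u t w + 2 * t * ‖x - w‖ ^ 2 := by
  set D := supConv B u t w + 2 * t * ‖x - w‖ ^ 2 - (supConv B u t z + 2 * t * ‖x - z‖ ^ 2) with hD
  have key : ∀ s : ℝ, 0 < s → s ≤ 1 → t * ‖w - z‖ ^ 2 * (1 - s) ≤ D := by
    intro s hs hs1
    have h1 := hz (z + s • (w - z))
    have h2 := supConv_lineMap_le hB hu ht z w hs.le hs1
    rw [norm_sub_lineMap_sq] at h1
    have h3 : s * (t * ‖w - z‖ ^ 2 * (1 - s)) ≤ s * D := by rw [hD]; linarith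
    exact le_of_mul_le_mul_left h3 hs
  have hlim : Filter.Tendsto (fun s : ℝ => t * ‖w - z‖ ^ 2 * (1 - s)) (𝓝[>] 0)
      (𝓝 (t * ‖w - z‖ ^ 2 * (1 - 0))) :=
    (Continuous.tendsto (by fun_prop) 0).mono_left nhdsWithin_le_nhds
  have := le_of_tendsto hlim (by
    filter_upwards [Ioc_mem_nhdsGT (zero_lt_one' ℝ)] with s hs using key s hs.1 hs.2)
  linarith

theorem exists_isMin_supConv_add [FiniteDimensional ℝ E] (hB : B.Nonempty)
    (hu : BddAbove (u '' B)) (ht : 0 < t) (x : E) :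
    ∃ z, ∀ w, supConv B u t z + 2 * t * ‖x - z‖ ^ 2 ≤
      supConv B u t w + 2 * t * ‖x - w‖ ^ 2 := by
  obtain ⟨a, ha⟩ := hB
  have hlsc : LowerSemicontinuous fun z => supConv B u t z + 2 * t * ‖x - z‖ ^ 2 := by
    refine LowerSemicontinuous.add ?_ (Continuous.lowerSemicontinuous (by fun_prop))
    exact lowerSemicontinuous_ciSup (bddAbove_supConv hu ht)
      fun a => Continuous.lowerSemicontinuous (by fun_prop)
  have hcoer : ∀ z, u a - 3 * t * ‖x - a‖ ^ 2 + t / 2 * ‖x - z‖ ^ 2 ≤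
      supConv B u t z + 2 * t * ‖x - z‖ ^ 2 := by
    intro z
    have h1 := le_supConv hu ht ha z
    have h2 : ‖a - z‖ ≤ ‖x - a‖ + ‖x - z‖ := by
      rw [← norm_neg (x - a), neg_sub]
      simpa using norm_add_le (a - x) (x - z)
    -- Young's inequality weighted so that 2t - 3t/2 = t/2 of the outer paraboloid survives as
    -- coercivity.
    have h3 : ‖a - z‖ ^ 2 ≤ 3 * ‖x - a‖ ^ 2 + 3 / 2 * ‖x - z‖ ^ 2 := by
      nlinarith [sq_nonneg (2 * ‖x - a‖ - ‖x - z‖), norm_nonneg (a - z)]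
    have h4 := mul_le_mul_of_nonneg_left h3 ht.le
    linarith
  set m := supConv B u t x + 2 * t * ‖x - x‖ ^ 2 with hm
  set R := 1 + |m - (u a - 3 * t * ‖x - a‖ ^ 2)| * (2 / t) with hR
  have hR1 : 1 ≤ R := by
    have : 0 ≤ |m - (u a - 3 * t * ‖x - a‖ ^ 2)| * (2 / t) := by positivity
    linarith
  obtain ⟨z, hz, hmin⟩ := (hlsc.lowerSemicontinuousOn _).exists_isMinOn
    (s := Metric.closedBall x R) ⟨x, by simp; linarith⟩ (isCompact_closedBall x R)
  refine ⟨z, fun w => ?_⟩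
  by_cases hw : w ∈ Metric.closedBall x R
  · exact hmin hw
  · refine (hmin (show x ∈ Metric.closedBall x R by simp; linarith)).trans ?_
    refine le_trans ?_ (hcoer w)
    have hw' : R < ‖x - w‖ := by
      simpa [Metric.mem_closedBall, dist_eq_norm, norm_sub_rev] using hw
    have h5 : R ≤ ‖x - w‖ ^ 2 := by nlinarith
    have h6 : |m - (u a - 3 * t * ‖x - a‖ ^ 2)| ≤ t / 2 * ‖x - w‖ ^ 2 := by
      calc |m - (u a - 3 * t * ‖x - a‖ ^ 2)| = t / 2 * (R - 1) := by rw [hR]; field_simp; ring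
        _ ≤ t / 2 * ‖x - w‖ ^ 2 := by gcongr; linarith
    have h7 := le_abs_self (m - (u a - 3 * t * ‖x - a‖ ^ 2))
    change m ≤ _
    linarith

/-- Quadratic growth at the minimizer Z x makes Z 2-Lipschitz, and the gradient is that of the outer
paraboloid with Z x frozen, 4t(x - Z x). Hence the Lipschitz constant 4t(1 + 2) = 12t. -/
theorem exists_lipschitz_gradient_envelope [FiniteDimensional ℝ E] (hB : B.Nonempty)
    (hu : BddAbove (u '' B)) (ht : 0 < t) :
    ∃ (K : NNReal) (G : E → E), LipschitzWith K G ∧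
      ∀ x, HasFDerivAt (envelope B u t) (innerSL ℝ (G x)) x := by
  choose Z hZ using exists_isMin_supConv_add hB hu ht
  have hval : ∀ x, envelope B u t x = supConv B u t (Z x) + 2 * t * ‖x - Z x‖ ^ 2 := fun x =>
    le_antisymm (envelope_le hB hu ht x (Z x)) (le_ciInf (hZ x))
  have hstrong : ∀ x w, envelope B u t x + t * ‖w - Z x‖ ^ 2 ≤
      supConv B u t w + 2 * t * ‖x - w‖ ^ 2 := fun x w => by
    rw [hval]; exact add_mul_norm_sq_le_of_isMin hB hu ht (hZ x) w
  have hexp : ∀ x y z : E, ‖y - z‖ ^ 2 = ‖x - z‖ ^ 2 + 2 * inner ℝ (x - z) (y - x) +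
      ‖y - x‖ ^ 2 := by
    intro x y z
    rw [← norm_add_sq_real]
    congr 2; abel
  have hLip : ∀ x y, ‖Z x - Z y‖ ≤ 2 * ‖x - y‖ := by
    intro x y
    have h1 := hstrong x (Z y)
    have h2 := hstrong y (Z x)
    rw [hval] at h1 h2
    rw [norm_sub_rev (Z y) (Z x)] at h1
    have h3 := hexp x y (Z x)
    have h4 := hexp x y (Z y)
    have h5 : inner ℝ (x - Z x) (y - x) - inner ℝ (x - Z y) (y - x) =
        -inner ℝ (Z x - Z y) (y - x) := by
      rw [← inner_sub_left, ← inner_neg_left]; congr 1; abel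
    have h6 := abs_real_inner_le_norm (Z x - Z y) (y - x)
    have h7 := neg_abs_le (inner ℝ (Z x - Z y) (y - x))
    have h8 : t * (‖Z x - Z y‖ * ‖Z x - Z y‖) ≤ t * (‖Z x - Z y‖ * (2 * ‖y - x‖)) := by
      nlinarith
    have h9 := le_of_mul_le_mul_left h8 ht
    rw [norm_sub_rev x y]
    rcases (norm_nonneg (Z x - Z y)).eq_or_lt with h0 | h0
    · rw [← h0]; positivity
    · exact le_of_mul_le_mul_left h9 h0
  refine ⟨Real.toNNReal (12 * t), fun x => (4 * t) • (x - Z x), ?_, ?_⟩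
  · refine LipschitzWith.of_dist_le_mul fun x y => ?_
    rw [dist_eq_norm, dist_eq_norm, Real.coe_toNNReal _ (by positivity), ← smul_sub, norm_smul,
      Real.norm_of_nonneg (by positivity)]
    have h1 : ‖x - Z x - (y - Z y)‖ ≤ ‖x - y‖ + ‖Z x - Z y‖ := by
      have : x - Z x - (y - Z y) = (x - y) - (Z x - Z y) := by abel
      rw [this]; exact norm_sub_le _ _
    nlinarith [hLip x y]
  · intro x
    -- The upper bound uses Z x as competitor at y. The lower bound uses growth at Z x, completing
    -- the square in Z y - Z x - 2(y - x).
    have hbound : ∀ y, |envelope B u t y - envelope B u t x -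
        inner ℝ ((4 * t) • (x - Z x)) (y - x)| ≤ 2 * t * ‖y - x‖ ^ 2 := by
      intro y
      rw [real_inner_smul_left, abs_le]
      have h1 := envelope_le hB hu ht y (Z x)
      have h2 := hstrong x (Z y)
      rw [hexp x y (Z x)] at h1
      have h3 := hval x
      have h4 := hval y
      rw [hexp x y (Z y)] at h4
      have h5 : inner ℝ (x - Z y) (y - x) = inner ℝ (x - Z x) (y - x) -
          inner ℝ (Z y - Z x) (y - x) := by
        rw [← inner_sub_left]; congr 1; abel
      have h6 : 0 ≤ t * (‖Z y - Z x‖ ^ 2 - 2 * inner ℝ (Z y - Z x) ((2 : ℝ) • (y - x)) +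
          ‖(2 : ℝ) • (y - x)‖ ^ 2) := by
        rw [← norm_sub_sq_real]; positivity
      rw [real_inner_smul_right, norm_smul, mul_pow, Real.norm_of_nonneg zero_le_two] at h6
      constructor
      · rw [h4, h5]; linarith
      · linarith
    rw [hasFDerivAt_iff_isLittleO]
    refine Asymptotics.IsBigO.trans_isLittleO (g := fun y => ‖y - x‖ ^ 2) ?_ ?_
    · refine Asymptotics.IsBigO.of_bound (2 * t) (Filter.Eventually.of_forall fun y => ?_)
      rw [Real.norm_eq_abs, innerSL_apply_apply]
      simpa using hbound y
    · exact Asymptotics.isLittleO_pow_sub_sub x (by norm_num)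

end Envelope

end PotentialTheory

/-! ### Rademacher, regular values and second order Taylor expansion -/

namespace PotentialTheory

/-- Almost every value of a Lipschitz self-map of a finite-dimensional space is attained only at
points of differentiability. -/
theorem exists_forall_differentiableAt_of_lipschitzWith {V : Type*} [NormedAddCommGroup V]
    [NormedSpace ℝ V] [FiniteDimensional ℝ V] {K : NNReal} {Θ : V → V} (hΘ : LipschitzWith K Θ)
    {δ : ℝ} (hδ : 0 < δ) :
    ∃ p ∈ Metric.ball (0 : V) δ, ∀ X, Θ X = p → DifferentiableAt ℝ Θ X := by
  borelize V
  -- Full-dimensional Hausdorff measure serves twice: as a Haar measure for Rademacher, and as a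
  -- measure scaling under Lipschitz maps, so null sets have null images.
  let μ : MeasureTheory.Measure V := MeasureTheory.Measure.hausdorffMeasure (Module.finrank ℝ V)
  have hN : μ {X | ¬ DifferentiableAt ℝ Θ X} = 0 := hΘ.ae_differentiableAt (μ := μ)
  have hI : μ (Θ '' {X | ¬ DifferentiableAt ℝ Θ X}) = 0 := by
    have := hΘ.hausdorffMeasure_image_le (d := Module.finrank ℝ V) (by positivity)
      {X | ¬ DifferentiableAt ℝ Θ X}
    change μ _ ≤ _ * μ _ at this
    rw [hN, mul_zero] at this
    simpa using this
  have hpos : 0 < μ (Metric.ball (0 : V) δ) := Metric.measure_ball_pos μ 0 hδ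
  obtain ⟨p, hp, hp'⟩ : ∃ p ∈ Metric.ball (0 : V) δ, p ∉ Θ '' {X | ¬ DifferentiableAt ℝ Θ X} := by
    by_contra! hcon
    exact absurd (MeasureTheory.measure_mono_null hcon hI) hpos.ne'
  refine ⟨p, hp, fun X hX => ?_⟩
  by_contra h
  exact hp' ⟨X, h, hX⟩

variable {E : Type*} [NormedAddCommGroup E] [InnerProductSpace ℝ E]

/-- Second order Taylor expansion with Peano remainder. -/
theorem eventually_abs_sub_taylor_le {f : E → ℝ} {G : E → E} {A : E →L[ℝ] E} {x : E}
    (hf : ∀ᶠ y in 𝓝 x, HasFDerivAt f (innerSL ℝ (G y)) y) (hG : HasFDerivAt G A x)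
    {ε : ℝ} (hε : 0 < ε) :
    ∀ᶠ y in 𝓝 x, |f y - f x - inner ℝ (G x) (y - x) - 1 / 2 * inner ℝ (A (y - x)) (y - x)| ≤
      ε * ‖y - x‖ ^ 2 := by
  have h1 := (hasFDerivAt_iff_isLittleO.1 hG).def hε
  obtain ⟨r, hr, hball⟩ := Metric.eventually_nhds_iff_ball.1 (hf.and h1)
  filter_upwards [Metric.ball_mem_nhds x hr] with y hy
  set h := y - x with hh
  have hmem : ∀ s ∈ Set.Icc (0 : ℝ) 1, x + s • h ∈ Metric.ball x r := by
    intro s hs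
    rw [Metric.mem_ball, dist_eq_norm, add_sub_cancel_left, norm_smul, Real.norm_of_nonneg hs.1]
    rw [Metric.mem_ball, dist_eq_norm] at hy
    exact lt_of_le_of_lt (mul_le_of_le_one_left (norm_nonneg _) hs.2) hy
  -- The mean value inequality is applied to the Taylor remainder along the segment, so only first
  -- order differentiability of G at x is needed.
  have hderiv : ∀ s ∈ Set.Icc (0 : ℝ) 1, HasDerivWithinAt
      (fun s : ℝ => f (x + s • h) - s * inner ℝ (G x) h - s ^ 2 / 2 * inner ℝ (A h) h)
      (inner ℝ (G (x + s • h) - G x - A (s • h)) h) (Set.Icc 0 1) s := by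
    intro s hs
    have hd1 : HasDerivAt (fun s : ℝ => x + s • h) h s := by
      simpa using ((hasDerivAt_id s).smul_const h).const_add x
    have hd2 := (hball _ (hmem s hs)).1.comp_hasDerivAt s hd1
    have hd3 : HasDerivAt (fun s : ℝ => s * inner ℝ (G x) h) (inner ℝ (G x) h) s := by
      simpa using (hasDerivAt_id s).mul_const (inner ℝ (G x) h)
    have hd4 : HasDerivAt (fun s : ℝ => s ^ 2 / 2 * inner ℝ (A h) h) (s * inner ℝ (A h) h) s := by
      have := (((hasDerivAt_id s).pow 2).div_const 2).mul_const (inner ℝ (A h) h)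
      simpa using this
    refine (((hd2.sub hd3).sub hd4).congr_deriv ?_).hasDerivWithinAt
    rw [innerSL_apply_apply, map_smul, inner_sub_left, inner_sub_left, real_inner_smul_left]
  have hbd : ∀ s ∈ Set.Ico (0 : ℝ) 1, ‖(inner ℝ (G (x + s • h) - G x - A (s • h)) h : ℝ)‖ ≤
      ε * ‖h‖ ^ 2 := by
    intro s hs
    have h2 := (hball _ (hmem s ⟨hs.1, hs.2.le⟩)).2
    rw [add_sub_cancel_left, norm_smul, Real.norm_of_nonneg hs.1] at h2
    refine (norm_inner_le_norm _ _).trans ?_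
    have h3 : ε * (s * ‖h‖) ≤ ε * ‖h‖ := by
      gcongr
      exact mul_le_of_le_one_left (norm_nonneg _) hs.2.le
    calc _ ≤ (ε * ‖h‖) * ‖h‖ := by gcongr; exact h2.trans h3
      _ = _ := by ring
  have := norm_image_sub_le_of_norm_deriv_le_segment_01' hderiv hbd
  rw [Real.norm_eq_abs] at this
  refine le_trans (le_of_eq ?_) this
  congr 1
  rw [one_smul, zero_smul, add_zero, hh, add_sub_cancel]
  ring

end PotentialTheory

/-! ### Doubling of variables: existence and localization of maxima -/

namespace PotentialTheory

variable {E : Type*} [NormedAddCommGroup E] [InnerProductSpace ℝ E]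

/-- `(p, A)` is a second order upper contact jet of `u` at `a`, in the sense of Peano. -/
def HasUpperJet (u : E → ℝ) (a p : E) (A : E →L[ℝ] E) : Prop :=
  ∀ ε > 0, ∀ᶠ y in 𝓝 a,
    u y ≤ u a + inner ℝ p (y - a) + 1 / 2 * inner ℝ (A (y - a)) (y - a) + ε * ‖y - a‖ ^ 2

/-- The functional maximized when doubling variables: `u` and `v` are evaluated at separate points
`a`, `b`, penalized by their distances to `x`, `y`, and tilted by a linear form. -/
noncomputable def doubling (u v q : E → ℝ) (T : ℝ) (p : E × E) (a b x y : E) : ℝ :=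
  u a + v b - 4 * T * ‖x - a‖ ^ 2 - 4 * T * ‖y - b‖ ^ 2 - q x - T * ‖x - y‖ ^ 2 -
    inner ℝ p.1 x - inner ℝ p.2 y

/-- Half of each 4T penalty absorbs the quadratic growth of -q and of the tilts. D depends on
neither T nor p, so the four points merge as T → ∞. -/
theorem exists_mul_norm_sq_le_of_doubling_nonneg {u v q : E → ℝ} {ρ C c : ℝ}
    (hu : ∀ a ∈ Metric.closedBall (0 : E) ρ, u a ≤ C)
    (hv : ∀ a ∈ Metric.closedBall (0 : E) ρ, v a ≤ C)
    (hc : 0 ≤ c) (hq : ∀ x, -(c * (1 + ‖x‖ ^ 2)) ≤ q x) :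
    ∃ D : ℝ, ∀ T ≥ c + 1, ∀ p : E × E, ‖p‖ ≤ 1 → ∀ a ∈ Metric.closedBall (0 : E) ρ,
      ∀ b ∈ Metric.closedBall (0 : E) ρ, ∀ x y, 0 ≤ doubling u v q T p a b x y →
      T * (‖x - a‖ ^ 2 + ‖y - b‖ ^ 2 + ‖x - y‖ ^ 2) ≤ D := by
  refine ⟨2 * C + c + 2 + (c + 1) * (2 * ρ ^ 2) + 2 * ρ ^ 2, ?_⟩
  intro T hT p hp a ha b hb x y h
  have hsq : ∀ a ∈ Metric.closedBall (0 : E) ρ, ∀ x, ‖x‖ ^ 2 ≤ 2 * ‖x - a‖ ^ 2 + 2 * ρ ^ 2 := by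
    intro a ha x
    rw [mem_closedBall_zero_iff] at ha
    have h1 : ‖x‖ ≤ ‖x - a‖ + ‖a‖ := by simpa using norm_add_le (x - a) a
    nlinarith [sq_nonneg (‖x - a‖ - ρ), norm_nonneg x, norm_nonneg a, norm_nonneg (x - a)]
  have hin : ∀ p x : E, ‖p‖ ≤ 1 → -inner ℝ p x ≤ 1 + ‖x‖ ^ 2 := by
    intro p x hp
    have h1 := neg_abs_le (inner ℝ p x)
    have h2 := abs_real_inner_le_norm p x
    nlinarith [sq_nonneg (‖x‖ - 1), norm_nonneg x, norm_nonneg p]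
  have h1 := hu a ha
  have h2 := hv b hb
  have h3 := hq x
  have h4 := hin p.1 x ((norm_fst_le p).trans hp)
  have h5 := hin p.2 y ((norm_snd_le p).trans hp)
  have h6 := mul_le_mul_of_nonneg_left (hsq a ha x) (show 0 ≤ c + 1 by linarith)
  have h7 := hsq b hb y
  have h8 : (c + 1) * ‖x - a‖ ^ 2 ≤ T * ‖x - a‖ ^ 2 := by gcongr
  have h9 : 1 * ‖y - b‖ ^ 2 ≤ T * ‖y - b‖ ^ 2 := by gcongr; linarith
  have h10 : 0 ≤ T * ‖x - a‖ ^ 2 := by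
    have : 0 ≤ T := by linarith
    positivity
  have h11 : 0 ≤ T * ‖y - b‖ ^ 2 := by
    have : 0 ≤ T := by linarith
    positivity
  unfold doubling at h
  linarith

variable [FiniteDimensional ℝ E]

/-- The origin gives a nonnegative value, while D ≤ T forces x and y within distance 1 of a and b
wherever the value is nonnegative. The search for a maximum is thus confined to compact balls. -/
theorem exists_isMax_doubling {u v q : E → ℝ} {ρ D T : ℝ} {p : E × E} (hρ : 0 < ρ)
    (hu : UpperSemicontinuousOn u (Metric.closedBall 0 ρ))
    (hv : UpperSemicontinuousOn v (Metric.closedBall 0 ρ)) (hq : Continuous q)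
    (h0 : q 0 ≤ u 0 + v 0) (hT : 0 < T) (hDT : D ≤ T)
    (hD : ∀ a ∈ Metric.closedBall (0 : E) ρ, ∀ b ∈ Metric.closedBall (0 : E) ρ, ∀ x y,
      0 ≤ doubling u v q T p a b x y → T * (‖x - a‖ ^ 2 + ‖y - b‖ ^ 2 + ‖x - y‖ ^ 2) ≤ D) :
    ∃ a ∈ Metric.closedBall (0 : E) ρ, ∃ b ∈ Metric.closedBall (0 : E) ρ, ∃ x y,
      0 ≤ doubling u v q T p a b x y ∧
      ∀ a' ∈ Metric.closedBall (0 : E) ρ, ∀ b' ∈ Metric.closedBall (0 : E) ρ, ∀ x' y',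
        doubling u v q T p a' b' x' y' ≤ doubling u v q T p a b x y := by
  set B := Metric.closedBall (0 : E) ρ with hB
  set B' := Metric.closedBall (0 : E) (ρ + 1) with hB'
  have h0B : (0 : E) ∈ B := by simp [hB, hρ.le]
  have h0B' : (0 : E) ∈ B' := by simp [hB']; linarith
  have husc : UpperSemicontinuousOn
      (fun X : (E × E) × (E × E) => doubling u v q T p X.1.1 X.1.2 X.2.1 X.2.2)
      ((B ×ˢ B) ×ˢ (B' ×ˢ B')) := by
    have h1 : UpperSemicontinuousOn (fun X : (E × E) × (E × E) => u X.1.1)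
        ((B ×ˢ B) ×ˢ (B' ×ˢ B')) :=
      hu.comp (g := fun X : (E × E) × (E × E) => X.1.1) (by fun_prop) (fun X hX => hX.1.1)
    have h2 : UpperSemicontinuousOn (fun X : (E × E) × (E × E) => v X.1.2)
        ((B ×ˢ B) ×ˢ (B' ×ˢ B')) :=
      hv.comp (g := fun X : (E × E) × (E × E) => X.1.2) (by fun_prop) (fun X hX => hX.1.2)
    have h3 : Continuous (fun X : (E × E) × (E × E) =>
        - 4 * T * ‖X.2.1 - X.1.1‖ ^ 2 - 4 * T * ‖X.2.2 - X.1.2‖ ^ 2 - q X.2.1 -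
          T * ‖X.2.1 - X.2.2‖ ^ 2 - inner ℝ p.1 X.2.1 - inner ℝ p.2 X.2.2) := by fun_prop
    have h4 : (fun X : (E × E) × (E × E) => doubling u v q T p X.1.1 X.1.2 X.2.1 X.2.2) =
        fun X => u X.1.1 + v X.1.2 + (- 4 * T * ‖X.2.1 - X.1.1‖ ^ 2 -
          4 * T * ‖X.2.2 - X.1.2‖ ^ 2 - q X.2.1 - T * ‖X.2.1 - X.2.2‖ ^ 2 -
          inner ℝ p.1 X.2.1 - inner ℝ p.2 X.2.2) := by
      funext X
      unfold doubling
      ring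
    rw [h4]
    exact (h1.add h2).add (h3.upperSemicontinuous.upperSemicontinuousOn _)
  have hne : ((B ×ˢ B) ×ˢ (B' ×ˢ B')).Nonempty := ⟨((0, 0), (0, 0)), ⟨h0B, h0B⟩, ⟨h0B', h0B'⟩⟩
  obtain ⟨X, hX, hmax⟩ := husc.exists_isMaxOn hne
    (((isCompact_closedBall _ _).prod (isCompact_closedBall _ _)).prod
      ((isCompact_closedBall _ _).prod (isCompact_closedBall _ _)))
  have hpos : 0 ≤ doubling u v q T p X.1.1 X.1.2 X.2.1 X.2.2 := by
    refine le_trans ?_ (hmax (show ((0, 0), (0, 0)) ∈ (B ×ˢ B) ×ˢ (B' ×ˢ B') from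
      ⟨⟨h0B, h0B⟩, ⟨h0B', h0B'⟩⟩))
    simp [doubling]; linarith
  refine ⟨X.1.1, hX.1.1, X.1.2, hX.1.2, X.2.1, X.2.2, hpos, fun a' ha' b' hb' x' y' => ?_⟩
  by_cases hneg : 0 ≤ doubling u v q T p a' b' x' y'
  swap
  · exact (not_le.1 hneg).le.trans hpos
  have h1 := hD a' ha' b' hb' x' y' hneg
  have h2 : T * (‖x' - a'‖ ^ 2 + ‖y' - b'‖ ^ 2 + ‖x' - y'‖ ^ 2) ≤ T * 1 := by linarith
  have h3 := le_of_mul_le_mul_left h2 hT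
  have hnear : ∀ a ∈ B, ∀ x : E, ‖x - a‖ ^ 2 ≤ 1 → x ∈ B' := by
    intro a ha x hx
    rw [hB, mem_closedBall_zero_iff] at ha
    rw [hB', mem_closedBall_zero_iff]
    have h4 : ‖x‖ ≤ ‖x - a‖ + ‖a‖ := by simpa using norm_add_le (x - a) a
    have h5 : ‖x - a‖ ≤ 1 := by nlinarith [norm_nonneg (x - a)]
    linarith
  refine hmax (show ((a', b'), (x', y')) ∈ (B ×ˢ B) ×ˢ (B' ×ˢ B') from
    ⟨⟨ha', hb'⟩, ⟨hnear a' ha' x' ?_, hnear b' hb' y' ?_⟩⟩) <;>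
  nlinarith [sq_nonneg ‖x' - a'‖, sq_nonneg ‖y' - b'‖, sq_nonneg ‖x' - y'‖]

/-- Otherwise, as T → ∞ and p → 0, the four points would accumulate at one w with q w ≤ u w + v w,
and strict contact leaves only w = 0. -/
theorem exists_forall_norm_lt_of_doubling_nonneg {u v q : E → ℝ} {ρ D T₀ ε η : ℝ}
    (hu : UpperSemicontinuousOn u (Metric.closedBall 0 ρ))
    (hv : UpperSemicontinuousOn v (Metric.closedBall 0 ρ)) (hq : Continuous q)
    (hε : 0 < ε) (hle : ∀ x ∈ Metric.closedBall (0 : E) ρ, u x + v x ≤ q x - ε * ‖x‖ ^ 2)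
    (hD : ∀ T ≥ T₀, ∀ p : E × E, ‖p‖ ≤ 1 → ∀ a ∈ Metric.closedBall (0 : E) ρ,
      ∀ b ∈ Metric.closedBall (0 : E) ρ, ∀ x y, 0 ≤ doubling u v q T p a b x y →
      T * (‖x - a‖ ^ 2 + ‖y - b‖ ^ 2 + ‖x - y‖ ^ 2) ≤ D) (hη : 0 < η) :
    ∃ N > 0, ∀ T ≥ N, ∀ p : E × E, ‖p‖ ≤ 1 / N → ∀ a ∈ Metric.closedBall (0 : E) ρ,
      ∀ b ∈ Metric.closedBall (0 : E) ρ, ∀ x y, 0 ≤ doubling u v q T p a b x y →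
      ‖a‖ < η ∧ ‖b‖ < η ∧ ‖x‖ < η ∧ ‖y‖ < η := by
  by_contra! hcon
  have hk : ∀ k : ℕ, (0 : ℝ) < k + 1 := fun k => by positivity
  choose T hT p hp a ha b hb x y hpos hfar using fun k : ℕ => hcon (k + 1) (hk k)
  have hkT : Filter.Tendsto (fun k : ℕ => (k : ℝ) + 1) Filter.atTop Filter.atTop :=
    Filter.tendsto_atTop_add_const_right _ _ tendsto_natCast_atTop_atTop
  have hTtop : Filter.Tendsto T Filter.atTop Filter.atTop := Filter.tendsto_atTop_mono hT hkT
  have hp0 : Filter.Tendsto p Filter.atTop (𝓝 0) := by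
    refine squeeze_zero_norm hp ?_
    simpa using tendsto_one_div_add_atTop_nhds_zero_nat (𝕜 := ℝ)
  have hsum : ∀ᶠ k in Filter.atTop,
      ‖x k - a k‖ ^ 2 + ‖y k - b k‖ ^ 2 + ‖x k - y k‖ ^ 2 ≤ D / T k := by
    filter_upwards [hTtop.eventually_ge_atTop T₀, hTtop.eventually_gt_atTop 0] with k h1 h2
    have h3 : ‖p k‖ ≤ 1 := (hp k).trans (by rw [div_le_one (hk k)]; simp)
    rw [le_div_iff₀ h2, mul_comm]
    exact hD _ h1 _ h3 _ (ha k) _ (hb k) _ _ (hpos k)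
  have hDT : Filter.Tendsto (fun k => D / T k) Filter.atTop (𝓝 0) := hTtop.const_div_atTop D
  have hzero : ∀ w : ℕ → E, (∀ k, ‖w k‖ ^ 2 ≤ ‖x k - a k‖ ^ 2 + ‖y k - b k‖ ^ 2 +
      ‖x k - y k‖ ^ 2) → Filter.Tendsto w Filter.atTop (𝓝 0) := by
    intro w hw
    rw [tendsto_zero_iff_norm_tendsto_zero]
    have h1 : Filter.Tendsto (fun k => ‖w k‖ ^ 2) Filter.atTop (𝓝 0) :=
      squeeze_zero' (Filter.Eventually.of_forall fun k => by positivity)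
        (by filter_upwards [hsum] with k h using (hw k).trans h) hDT
    have h2 := h1.sqrt
    simpa [Real.sqrt_sq] using h2
  have hxa := hzero (fun k => x k - a k) fun k => by
    nlinarith [sq_nonneg ‖y k - b k‖, sq_nonneg ‖x k - y k‖]
  have hyb := hzero (fun k => y k - b k) fun k => by
    nlinarith [sq_nonneg ‖x k - a k‖, sq_nonneg ‖x k - y k‖]
  have hxy := hzero (fun k => x k - y k) fun k => by
    nlinarith [sq_nonneg ‖x k - a k‖, sq_nonneg ‖y k - b k‖]
  obtain ⟨w, hw, ψ, hψ, hlim⟩ := (isCompact_closedBall (0 : E) ρ).tendsto_subseq ha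
  have hψt := hψ.tendsto_atTop
  have la : Filter.Tendsto (fun k => a (ψ k)) Filter.atTop (𝓝 w) := hlim
  have lx : Filter.Tendsto (fun k => x (ψ k)) Filter.atTop (𝓝 w) := by
    simpa using (hxa.comp hψt).add la
  have ly : Filter.Tendsto (fun k => y (ψ k)) Filter.atTop (𝓝 w) := by
    simpa using lx.sub (hxy.comp hψt)
  have lb : Filter.Tendsto (fun k => b (ψ k)) Filter.atTop (𝓝 w) := by
    simpa using ly.sub (hyb.comp hψt)
  have lp : Filter.Tendsto (fun k => p (ψ k)) Filter.atTop (𝓝 0) := hp0.comp hψt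
  have hlow : Filter.Tendsto (fun k => q (x (ψ k)) + inner ℝ (p (ψ k)).1 (x (ψ k)) +
      inner ℝ (p (ψ k)).2 (y (ψ k))) Filter.atTop (𝓝 (q w)) := by
    have h1 := (((hq.tendsto w).comp lx).add ((continuous_fst.tendsto _ |>.comp lp).inner lx)).add
      ((continuous_snd.tendsto _ |>.comp lp).inner ly)
    simpa using h1
  have hval : q w ≤ u w + v w := by
    refine le_of_forall_pos_le_add fun e he => ?_
    have h1 : ∀ᶠ k in Filter.atTop, u (a (ψ k)) < u w + e / 2 :=
      (tendsto_nhdsWithin_iff.2 ⟨la, Filter.Eventually.of_forall fun k => ha _⟩).eventually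
        (hu w hw (u w + e / 2) (by linarith))
    have h2 : ∀ᶠ k in Filter.atTop, v (b (ψ k)) < v w + e / 2 :=
      (tendsto_nhdsWithin_iff.2 ⟨lb, Filter.Eventually.of_forall fun k => hb _⟩).eventually
        (hv w hw (v w + e / 2) (by linarith))
    refine le_of_tendsto hlow ?_
    filter_upwards [h1, h2] with k h1 h2
    have h3 := hpos (ψ k)
    have h4 : 0 ≤ T (ψ k) := (hk _).le.trans (hT _)
    have h5 : 0 ≤ T (ψ k) * ‖x (ψ k) - a (ψ k)‖ ^ 2 := by positivity
    have h6 : 0 ≤ T (ψ k) * ‖y (ψ k) - b (ψ k)‖ ^ 2 := by positivity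
    have h7 : 0 ≤ T (ψ k) * ‖x (ψ k) - y (ψ k)‖ ^ 2 := by positivity
    unfold doubling at h3
    linarith
  have hw0 : w = 0 := by
    have h1 := hle w hw
    have h2 : ε * ‖w‖ ^ 2 ≤ 0 := by linarith
    have h3 : ‖w‖ ^ 2 ≤ 0 := by nlinarith
    exact norm_eq_zero.1 (pow_eq_zero_iff (n := 2) (by norm_num) |>.1
      (le_antisymm h3 (by positivity)))
  subst hw0
  have hev : ∀ {f : ℕ → E}, Filter.Tendsto f Filter.atTop (𝓝 0) →
      ∀ᶠ k in Filter.atTop, ‖f k‖ < η := fun h => by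
    simpa using h.eventually (Metric.ball_mem_nhds 0 hη)
  obtain ⟨k, h1, h2, h3, h4⟩ := ((hev la).and ((hev lb).and ((hev lx).and (hev ly)))).exists
  exact absurd (hfar _ h1 h2 h3) (not_le.2 h4)

end PotentialTheory

/-! ### The theorem on sums -/

namespace PotentialTheory

variable {E : Type*} [NormedAddCommGroup E] [InnerProductSpace ℝ E]

theorem gradient_eq_of_le_paraboloid {g : E → ℝ} {x G d : E} {C : ℝ}
    (hg : HasFDerivAt g (innerSL ℝ G) x)
    (hle : ∀ y, g y ≤ g x + inner ℝ d (y - x) + C * ‖y - x‖ ^ 2) : G = d := by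
  have h1 : HasFDerivAt (fun y => inner ℝ d (y - x)) (innerSL ℝ d) x := by
    simpa [inner_sub_right] using (innerSL ℝ d).hasFDerivAt.sub_const (inner ℝ d x)
  have h2 : HasFDerivAt (fun y => C * ‖y - x‖ ^ 2) (0 : E →L[ℝ] ℝ) x := by
    have := (((hasFDerivAt_id x).sub_const x).norm_sq).const_mul C
    simpa using this
  have h3 : IsLocalMax (fun y => g y - inner ℝ d (y - x) - C * ‖y - x‖ ^ 2) x :=
    Filter.Eventually.of_forall fun y => by
      have := hle y
      simp only [sub_self, inner_zero_right, norm_zero]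
      linarith
  have h4 := h3.hasFDerivAt_eq_zero ((hg.sub h1).sub h2)
  rw [sub_zero, ← map_sub] at h4
  have h5 := DFunLike.congr_fun h4 (G - d)
  rw [innerSL_apply_apply, zero_apply, inner_self_eq_zero] at h5
  exact sub_eq_zero.1 h5

/-- At a common contact point, the Hessians of `f` and `g` are dominated by that of a quadratic
lying above their sum along the diagonal. -/
theorem inner_add_inner_le_of_add_le_quadratic {f g : E → ℝ} {F G : E → E} {A A' L : E →L[ℝ] E}
    {x y d : E} (hf : ∀ z, HasFDerivAt f (innerSL ℝ (F z)) z) (hF : HasFDerivAt F A x)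
    (hg : ∀ z, HasFDerivAt g (innerSL ℝ (G z)) z) (hG : HasFDerivAt G A' y)
    (hd : F x + G y = d)
    (hle : ∀ h, f (x + h) + g (y + h) ≤ f x + g y + inner ℝ d h + 1 / 2 * inner ℝ (L h) h)
    (h : E) : inner ℝ (A h) h + inner ℝ (A' h) h ≤ (inner ℝ (L h) h : ℝ) := by
  have key : ∀ ε > 0, 1 / 2 * inner ℝ (A h) h + 1 / 2 * inner ℝ (A' h) h ≤
      1 / 2 * inner ℝ (L h) h + ε * (2 * ‖h‖ ^ 2) := by
    intro ε hε
    have ht : ∀ z : E, Filter.Tendsto (fun s : ℝ => z + s • h) (𝓝[>] 0) (𝓝 z) := by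
      intro z
      have : Filter.Tendsto (fun s : ℝ => z + s • h) (𝓝 0) (𝓝 (z + (0 : ℝ) • h)) :=
        Continuous.tendsto (by fun_prop) 0
      rw [zero_smul, add_zero] at this
      exact this.mono_left nhdsWithin_le_nhds
    have e1 := (ht x).eventually
      (eventually_abs_sub_taylor_le (Filter.Eventually.of_forall hf) hF hε)
    have e2 := (ht y).eventually
      (eventually_abs_sub_taylor_le (Filter.Eventually.of_forall hg) hG hε)
    -- One small s > 0 suffices: the first order terms cancel by `hd`, and everything left scales
    -- like s².
    obtain ⟨s, ⟨h1, h2⟩, hs⟩ := ((e1.and e2).and self_mem_nhdsWithin).exists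
    have h3 := hle (s • h)
    rw [← hd, inner_add_left] at h3
    rw [add_sub_cancel_left] at h1 h2
    have h1' := (abs_le.1 h1).1
    have h2' := (abs_le.1 h2).1
    simp only [map_smul, real_inner_smul_left, real_inner_smul_right, norm_smul, mul_pow,
      Real.norm_eq_abs, sq_abs] at h1' h2' h3
    have hs2 : 0 < s ^ 2 := pow_pos hs 2
    refine le_of_mul_le_mul_left ?_ hs2
    linarith
  have hlim : 1 / 2 * inner ℝ (A h) h + 1 / 2 * inner ℝ (A' h) h ≤
      (1 / 2 * inner ℝ (L h) h : ℝ) := by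
    refine le_of_forall_pos_le_add fun e he => ?_
    have h1 := key (e / (2 * ‖h‖ ^ 2 + 1)) (by positivity)
    have h2 : e / (2 * ‖h‖ ^ 2 + 1) * (2 * ‖h‖ ^ 2) ≤ e := by
      rw [div_mul_eq_mul_div, div_le_iff₀ (by positivity)]
      nlinarith
    linarith
  linarith

/-- Sup-convolution principle: moving the argument and the competitor together keeps the penalty
constant, so the envelope's jet at x is an upper jet of u at a. -/
theorem hasUpperJet_of_le_translate {u g : E → ℝ} {G : E → E} {A : E →L[ℝ] E} {a x : E} {c : ℝ}
    (hg : ∀ z, HasFDerivAt g (innerSL ℝ (G z)) z) (hG : HasFDerivAt G A x)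
    (hle : ∀ᶠ y in 𝓝 a, u y ≤ g (y + (x - a)) + c) (heq : u a = g x + c) :
    HasUpperJet u a (G x) A := by
  intro ε hε
  have ht : Filter.Tendsto (fun y : E => y + (x - a)) (𝓝 a) (𝓝 x) := by
    have : Filter.Tendsto (fun y : E => y + (x - a)) (𝓝 a) (𝓝 (a + (x - a))) :=
      Continuous.tendsto (by fun_prop) a
    rwa [add_sub_cancel] at this
  filter_upwards [hle, ht.eventually
    (eventually_abs_sub_taylor_le (Filter.Eventually.of_forall hg) hG hε)] with y h1 h2
  have h3 : y + (x - a) - x = y - a := by abel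
  rw [h3] at h2
  have := (abs_le.1 h2).2
  linarith

/-- The quadratic polynomial `r + ⟪p, x⟫ + ⟪L x, x⟫ / 2`. -/
noncomputable def quadPoly (r : ℝ) (p : E) (L : E →L[ℝ] E) (x : E) : ℝ :=
  r + inner ℝ p x + 1 / 2 * inner ℝ (L x) x

theorem quadPoly_zero (r : ℝ) (p : E) (L : E →L[ℝ] E) : quadPoly r p L 0 = r := by
  simp [quadPoly]

theorem continuous_quadPoly (r : ℝ) (p : E) (L : E →L[ℝ] E) : Continuous (quadPoly r p L) := by
  unfold quadPoly
  fun_prop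

theorem quadPoly_add {L : E →L[ℝ] E} (hL : ∀ x y, inner ℝ (L x) y = inner ℝ (L y) x)
    (r : ℝ) (p x h : E) :
    quadPoly r p L (x + h) = quadPoly r p L x + inner ℝ (p + L x) h +
      1 / 2 * inner ℝ (L h) h := by
  have := hL x h
  simp only [quadPoly, map_add, inner_add_left, inner_add_right]
  linarith

theorem half_inner_apply_le (L : E →L[ℝ] E) (x : E) :
    |1 / 2 * inner ℝ (L x) x| ≤ 1 / 2 * (‖L‖ * ‖x‖ ^ 2) := by
  rw [abs_mul, abs_of_pos (show (0 : ℝ) < 1 / 2 by norm_num)]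
  refine mul_le_mul_of_nonneg_left ((abs_real_inner_le_norm _ _).trans ?_) (by norm_num)
  nlinarith [L.le_opNorm x, norm_nonneg x]

theorem neg_le_quadPoly (r : ℝ) (p : E) (L : E →L[ℝ] E) (x : E) :
    -((|r| + ‖p‖ + ‖L‖) * (1 + ‖x‖ ^ 2)) ≤ quadPoly r p L x := by
  have h1 := (abs_le.1 (half_inner_apply_le L x)).1
  have h2 := (abs_le.1 (abs_real_inner_le_norm p x)).1
  have h3 := neg_abs_le r
  have h4 : ‖p‖ * ‖x‖ ≤ ‖p‖ * (1 + ‖x‖ ^ 2) := by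
    gcongr
    nlinarith [sq_nonneg (‖x‖ - 1)]
  have h5 : 0 ≤ |r| * ‖x‖ ^ 2 := by positivity
  have h6 : 0 ≤ ‖L‖ * ‖x‖ ^ 2 := by positivity
  have h7 := norm_nonneg L
  unfold quadPoly
  linarith

variable [FiniteDimensional ℝ E]

/-- A maximum point of the doubling functional gives second order upper contact jets of `u` and
`v`, provided that the tilt `p` is a regular value in the sense of Rademacher's theorem. -/
theorem exists_hasUpperJet_of_isMax_doubling {u v : E → ℝ} {ρ T δ r : ℝ} {p₀ : E}
    {L : E →L[ℝ] E} (hL : ∀ x y, inner ℝ (L x) y = inner ℝ (L y) x)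
    (hu : BddAbove (u '' Metric.closedBall 0 ρ)) (hv : BddAbove (v '' Metric.closedBall 0 ρ))
    (hρ : 0 < ρ) (hT : 0 < T) (hLT : ‖L‖ ≤ T) (hδ : 0 < δ) :
    ∃ p : E × E, ‖p‖ < δ ∧ ∀ a ∈ Metric.ball (0 : E) ρ, ∀ b ∈ Metric.ball (0 : E) ρ, ∀ x y,
      (∀ a' ∈ Metric.closedBall (0 : E) ρ, ∀ b' ∈ Metric.closedBall (0 : E) ρ, ∀ x' y',
        doubling u v (quadPoly r p₀ L) T p a' b' x' y' ≤
          doubling u v (quadPoly r p₀ L) T p a b x y) →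
      ∃ (p₁ p₂ : E) (A₁ A₂ : E →L[ℝ] E), HasUpperJet u a p₁ A₁ ∧ HasUpperJet v b p₂ A₂ ∧
        p₁ + p₂ = p₀ + L x + p.1 + p.2 ∧
        ∀ h, inner ℝ (A₁ h) h + inner ℝ (A₂ h) h ≤ (inner ℝ (L h) h : ℝ) := by
  set B := Metric.closedBall (0 : E) ρ with hB
  have hne : B.Nonempty := ⟨0, by simp [hB, hρ.le]⟩
  have ht : 0 < 2 * T := by positivity
  obtain ⟨K₁, G₁, hK₁, hG₁⟩ := exists_lipschitz_gradient_envelope hne hu ht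
  obtain ⟨K₂, G₂, hK₂, hG₂⟩ := exists_lipschitz_gradient_envelope hne hv ht
  let Ξ : E × E → E × E := fun X => (G₁ X.1, G₂ X.2)
  have hΞ : LipschitzWith (max K₁ K₂) Ξ := by
    have := (hK₁.comp (LipschitzWith.prod_fst (α := E) (β := E))).prodMk
      (hK₂.comp (LipschitzWith.prod_snd (α := E) (β := E)))
    simpa using this
  let Λ : E × E →L[ℝ] E × E :=
    ((L.comp (ContinuousLinearMap.fst ℝ E E)) +
      (2 * T) • (ContinuousLinearMap.fst ℝ E E - ContinuousLinearMap.snd ℝ E E)).prod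
      ((2 * T) • (ContinuousLinearMap.snd ℝ E E - ContinuousLinearMap.fst ℝ E E))
  -- This map is the gradient of the envelope sum minus that of the untilted penalized quadratic. It
  -- equals p at every contact point, so p can be fixed before the maximum is known.
  have hΘ : LipschitzWith (max K₁ K₂ + (‖Λ‖₊ + 0)) fun X => Ξ X - (Λ X + (p₀, 0)) :=
    hΞ.sub (Λ.lipschitz.add (LipschitzWith.const (p₀, (0 : E))))
  obtain ⟨p, hp, hdiff⟩ := exists_forall_differentiableAt_of_lipschitzWith hΘ hδ
  refine ⟨p, by simpa using hp, fun a ha b hb x y hmax => ?_⟩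
  have haB : a ∈ B := Metric.ball_subset_closedBall ha
  have hbB : b ∈ B := Metric.ball_subset_closedBall hb
  set m := doubling u v (quadPoly r p₀ L) T p a b x y with hm
  -- The constant m turns maximality into domination by Ψ with equality at (a, b, x, y).
  let Ψ : E → E → ℝ := fun x y =>
    quadPoly r p₀ L x + T * ‖x - y‖ ^ 2 + inner ℝ p.1 x + inner ℝ p.2 y + m
  let d : E → E → E := fun x y => p₀ + L x + (2 * T) • (x - y) + p.1
  let e : E → E → E := fun x y => (2 * T) • (y - x) + p.2
  have hΨ : ∀ x y h k, Ψ (x + h) (y + k) = Ψ x y + inner ℝ (d x y) h + inner ℝ (e x y) k +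
      1 / 2 * inner ℝ (L h) h + T * ‖h - k‖ ^ 2 := by
    intro x y h k
    have h1 : x + h - (y + k) = (x - y) + (h - k) := by abel
    have h2 : y - x = -(x - y) := by abel
    simp only [Ψ, quadPoly_add hL, h1, h2, d, e, norm_add_sq_real (x - y) (h - k),
      inner_add_left, inner_add_right, inner_smul_left, inner_sub_right, inner_neg_left,
      RCLike.conj_to_real]
    ring
  have hΨle : ∀ x y h k, Ψ (x + h) (y + k) ≤ Ψ x y + inner ℝ (d x y) h + inner ℝ (e x y) k +
      2 * (2 * T) * (‖h‖ ^ 2 + ‖k‖ ^ 2) := by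
    intro x y h k
    have h1 := (abs_le.1 (half_inner_apply_le L h)).2
    have h2 : ‖L‖ * ‖h‖ ^ 2 ≤ T * ‖h‖ ^ 2 := by gcongr
    have h3 : ‖h - k‖ ^ 2 ≤ 2 * ‖h‖ ^ 2 + 2 * ‖k‖ ^ 2 := by
      simpa using norm_sub_sq_le_two_mul h 0 k
    have h4 := mul_le_mul_of_nonneg_left h3 hT.le
    have h5 : 0 ≤ T * ‖h‖ ^ 2 := by positivity
    have h6 : 0 ≤ T * ‖k‖ ^ 2 := by positivity
    rw [hΨ]
    linarith
  have hbelow : ∀ a ∈ B, ∀ b ∈ B, ∀ x y,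
      u a - 2 * (2 * T) * ‖x - a‖ ^ 2 + (v b - 2 * (2 * T) * ‖y - b‖ ^ 2) ≤ Ψ x y := by
    intro a' ha' b' hb' x' y'
    have := hmax a' ha' b' hb' x' y'
    unfold doubling at this
    simp only [Ψ]
    linarith
  have htouch : ∀ x' y', envelope B u (2 * T) x' + envelope B v (2 * T) y' ≤ Ψ x' y' := by
    intro x' y'
    refine envelope_add_envelope_le hne hu hv ht hbelow (d := d x' y') (e := e x' y')
      fun x₁ y₁ => ?_
    simpa using hΨle x' y' (x₁ - x') (y₁ - y')
  have hmval : Ψ x y = u a - 2 * (2 * T) * ‖x - a‖ ^ 2 + (v b - 2 * (2 * T) * ‖y - b‖ ^ 2) := by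
    simp only [Ψ, hm, doubling]
    ring
  have hua := sub_le_envelope hu ht haB x
  have hvb := sub_le_envelope hv ht hbB y
  have hcontact := htouch x y
  have heq : envelope B u (2 * T) x + envelope B v (2 * T) y = Ψ x y := by linarith
  have hg₁ : G₁ x = d x y := gradient_eq_of_le_paraboloid (C := 2 * (2 * T)) (hG₁ x) fun z => by
    have h1 := htouch z y
    have h2 := hΨle x y (z - x) 0
    simp only [add_sub_cancel, add_zero, inner_zero_right, norm_zero] at h2
    linarith
  have hg₂ : G₂ y = e x y := gradient_eq_of_le_paraboloid (C := 2 * (2 * T)) (hG₂ y) fun z => by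
    have h1 := htouch x z
    have h2 := hΨle x y 0 (z - y)
    simp only [add_sub_cancel, add_zero, inner_zero_right, norm_zero] at h2
    linarith
  have hΞd : DifferentiableAt ℝ Ξ (x, y) := by
    have h1 : Ξ (x, y) - (Λ (x, y) + (p₀, 0)) = p := by
      refine Prod.ext ?_ ?_
      · simp [Ξ, Λ, hg₁, d]
        module
      · simp [Ξ, Λ, hg₂, e]
    have h2 := (hdiff (x, y) h1).add (Λ.differentiableAt.add_const (p₀, (0 : E)))
    simpa [Pi.add_def] using h2
  have hA₁ : DifferentiableAt ℝ G₁ x := by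
    have h1 : DifferentiableAt ℝ (fun z : E => (z, y)) x := by fun_prop
    exact (DifferentiableAt.comp x (f := fun z : E => (z, y)) hΞd h1).fst
  have hA₂ : DifferentiableAt ℝ G₂ y := by
    have h1 : DifferentiableAt ℝ (fun z : E => (x, z)) y := by fun_prop
    exact (DifferentiableAt.comp y (f := fun z : E => (x, z)) hΞd h1).snd
  have hjet : ∀ {w : E → ℝ} {G : E → E} {c z : E}, BddAbove (w '' B) →
      (∀ z, HasFDerivAt (envelope B w (2 * T)) (innerSL ℝ (G z)) z) → DifferentiableAt ℝ G z →
      c ∈ Metric.ball (0 : E) ρ → w c = envelope B w (2 * T) z + 2 * (2 * T) * ‖z - c‖ ^ 2 →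
      HasUpperJet w c (G z) (fderiv ℝ G z) := by
    intro w G c z hw hG hGz hc hval
    refine hasUpperJet_of_le_translate hG hGz.hasFDerivAt ?_ hval
    filter_upwards [Metric.isOpen_ball.mem_nhds hc] with c' hc'
    have h1 := sub_le_envelope hw ht (Metric.ball_subset_closedBall hc') (c' + (z - c))
    rw [add_sub_cancel_left] at h1
    linarith
  refine ⟨G₁ x, G₂ y, fderiv ℝ G₁ x, fderiv ℝ G₂ y, hjet hu hG₁ hA₁ ha (by linarith),
    hjet hv hG₂ hA₂ hb (by linarith), ?_, ?_⟩
  · rw [hg₁, hg₂]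
    simp only [d, e]
    module
  · refine inner_add_inner_le_of_add_le_quadratic hG₁ hA₁.hasFDerivAt hG₂ hA₂.hasFDerivAt
      (d := d x y + e x y) (by rw [hg₁, hg₂]) fun h => ?_
    -- Equal increments in both variables make T‖h - k‖² vanish.
    have h1 := htouch (x + h) (y + h)
    rw [hΨ, sub_self, norm_zero] at h1
    rw [inner_add_left]
    linarith

/-- **Theorem on sums.** If `u + v` is touched strictly from above at the origin by a quadratic
polynomial, then near the origin `u` and `v` have upper contact jets whose sum is
approximately bounded by the jet of the polynomial. -/
theorem exists_hasUpperJet_of_add_le_quadPoly {u v : E → ℝ} {ρ ε η r : ℝ} {p₀ : E}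
    {L : E →L[ℝ] E} (hL : ∀ x y, inner ℝ (L x) y = inner ℝ (L y) x) (hρ : 0 < ρ)
    (hu : UpperSemicontinuousOn u (Metric.closedBall 0 ρ))
    (hv : UpperSemicontinuousOn v (Metric.closedBall 0 ρ)) (hε : 0 < ε)
    (hle : ∀ x ∈ Metric.closedBall (0 : E) ρ, u x + v x ≤ quadPoly r p₀ L x - ε * ‖x‖ ^ 2)
    (h0 : u 0 + v 0 = r) (hη : 0 < η) :
    ∃ a ∈ Metric.ball (0 : E) η, ∃ b ∈ Metric.ball (0 : E) η,
      ∃ (p₁ p₂ : E) (A₁ A₂ : E →L[ℝ] E), HasUpperJet u a p₁ A₁ ∧ HasUpperJet v b p₂ A₂ ∧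
        ‖p₁ + p₂ - p₀‖ < η ∧ (∀ h, inner ℝ (A₁ h) h + inner ℝ (A₂ h) h ≤ (inner ℝ (L h) h : ℝ)) ∧
        r - η < u a + v b := by
  have hub := hu.bddAbove_of_isCompact (isCompact_closedBall _ _)
  have hvb := hv.bddAbove_of_isCompact (isCompact_closedBall _ _)
  obtain ⟨C₁, hC₁⟩ := hub
  obtain ⟨C₂, hC₂⟩ := hvb
  have hq := continuous_quadPoly r p₀ L
  obtain ⟨D, hD⟩ := exists_mul_norm_sq_le_of_doubling_nonneg (u := u) (v := v) (ρ := ρ)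
    (C := max C₁ C₂) (fun a ha => (hC₁ ⟨a, ha, rfl⟩).trans (le_max_left _ _))
    (fun a ha => (hC₂ ⟨a, ha, rfl⟩).trans (le_max_right _ _)) (by positivity)
    (neg_le_quadPoly r p₀ L)
  obtain ⟨σ, hσ, hσq⟩ := Metric.continuousAt_iff.1 (hq.continuousAt (x := 0)) (η / 2) (by positivity)
  -- The last entry makes ‖L x‖ ≤ η/2, and σ makes the quadratic vary by less than η/2; the tilts
  -- contribute at most η/8 each.
  set η' := min (min η ρ) (min (min 1 σ) (η / (2 * (‖L‖ + 1)))) with hη'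
  have hη'pos : 0 < η' := by positivity
  obtain ⟨N, hN, hloc⟩ := exists_forall_norm_lt_of_doubling_nonneg hu hv hq hε hle hD hη'pos
  set c := |r| + ‖p₀‖ + ‖L‖ with hc
  set T := max (max N (c + 1)) D with hT
  have hTN : N ≤ T := (le_max_left _ _).trans (le_max_left _ _)
  have hTc : c + 1 ≤ T := (le_max_right _ _).trans (le_max_left _ _)
  have hTpos : 0 < T := hN.trans_le hTN
  have hLT : ‖L‖ ≤ T := by
    have := abs_nonneg r
    have := norm_nonneg p₀
    linarith
  set δ := min (min (1 / N) 1) (η / 8) with hδ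
  have hδpos : 0 < δ := by positivity
  obtain ⟨p, hp, hjets⟩ := exists_hasUpperJet_of_isMax_doubling (p₀ := p₀) (r := r) hL
    ⟨C₁, hC₁⟩ ⟨C₂, hC₂⟩ hρ hTpos hLT hδpos
  have hpN : ‖p‖ ≤ 1 / N := hp.le.trans ((min_le_left _ _).trans (min_le_left _ _))
  have hp1 : ‖p‖ ≤ 1 := hp.le.trans ((min_le_left _ _).trans (min_le_right _ _))
  have hpη : ‖p‖ < η / 8 := hp.trans_le (min_le_right _ _)
  obtain ⟨a, ha, b, hb, x, y, hnonneg, hmax⟩ := exists_isMax_doubling hρ hu hv hq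
    (by rw [quadPoly_zero, h0]) hTpos (le_max_right _ _) (hD T hTc p hp1)
  obtain ⟨na, nb, nx, ny⟩ := hloc T hTN p hpN a ha b hb x y hnonneg
  have l1 : η' ≤ η := (min_le_left _ _).trans (min_le_left _ _)
  have l2 : η' ≤ ρ := (min_le_left _ _).trans (min_le_right _ _)
  have l3 : η' ≤ 1 := (min_le_right _ _).trans ((min_le_left _ _).trans (min_le_left _ _))
  have l4 : η' ≤ σ := (min_le_right _ _).trans ((min_le_left _ _).trans (min_le_right _ _))
  have l5 : η' ≤ η / (2 * (‖L‖ + 1)) := (min_le_right _ _).trans (min_le_right _ _)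
  obtain ⟨p₁, p₂, A₁, A₂, hj₁, hj₂, hsum, hA⟩ := hjets a (by simpa using na.trans_le l2) b
    (by simpa using nb.trans_le l2) x y hmax
  have hp₁ := norm_fst_le p
  have hp₂ := norm_snd_le p
  refine ⟨a, by simpa using na.trans_le l1, b, by simpa using nb.trans_le l1, p₁, p₂, A₁, A₂,
    hj₁, hj₂, ?_, hA, ?_⟩
  · have h1 : p₁ + p₂ - p₀ = L x + p.1 + p.2 := by rw [hsum]; abel
    have h2 : ‖L x‖ ≤ η / 2 := by
      calc ‖L x‖ ≤ ‖L‖ * ‖x‖ := L.le_opNorm x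
        _ ≤ (‖L‖ + 1) * (η / (2 * (‖L‖ + 1))) := by
          gcongr
          · linarith
          · exact nx.le.trans l5
        _ = η / 2 := by
          have : ‖L‖ + 1 ≠ 0 := by positivity
          field_simp
    rw [h1]
    have h3 := norm_add₃_le (a := L x) (b := p.1) (c := p.2)
    linarith
  · have h1 := hσq (x := x) (by simpa using nx.trans_le l4)
    rw [quadPoly_zero, Real.dist_eq] at h1
    have h2 := (abs_lt.1 h1).1
    have hin : ∀ w z : E, ‖w‖ ≤ ‖p‖ → ‖z‖ < η' → -(η / 8) ≤ inner ℝ w z := by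
      intro w z hw hz
      have h3 := (abs_le.1 (abs_real_inner_le_norm w z)).1
      have h4 : ‖w‖ * ‖z‖ ≤ η / 8 * 1 := by
        gcongr
        · linarith
        · linarith
      linarith
    have h3 := hin p.1 x hp₁ nx
    have h4 := hin p.2 y hp₂ ny
    have h5 : 0 ≤ T * ‖x - a‖ ^ 2 := by positivity
    have h6 : 0 ≤ T * ‖y - b‖ ^ 2 := by positivity
    have h7 : 0 ≤ T * ‖x - y‖ ^ 2 := by positivity
    unfold doubling at hnonneg
    linarith

end PotentialTheory

/-! ### Jets of quadratic polynomials -/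

namespace PotentialTheory

variable {n : ℕ}

/-- The symmetric matrix of the quadratic form `h ↦ ⟪A h, h⟫`. -/
noncomputable def symPart (A : EuclideanSpace ℝ (Fin n) →L[ℝ] EuclideanSpace ℝ (Fin n)) :
    SymMat n :=
  ⟨Matrix.of fun i j =>
    (inner ℝ (A (EuclideanSpace.single i 1)) (EuclideanSpace.single j 1) +
      inner ℝ (A (EuclideanSpace.single j 1)) (EuclideanSpace.single i 1)) / 2, by
    rw [selfAdjoint.mem_iff]
    ext i j
    simp [Matrix.star_apply, add_comm]⟩

theorem symPart_apply (A : EuclideanSpace ℝ (Fin n) →L[ℝ] EuclideanSpace ℝ (Fin n))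
    (i j : Fin n) : (symPart A : Matrix (Fin n) (Fin n) ℝ) i j =
      (inner ℝ (A (EuclideanSpace.single i 1)) (EuclideanSpace.single j 1) +
        inner ℝ (A (EuclideanSpace.single j 1)) (EuclideanSpace.single i 1)) / 2 := rfl

theorem symPart_add (A A' : EuclideanSpace ℝ (Fin n) →L[ℝ] EuclideanSpace ℝ (Fin n)) :
    symPart (A + A') = symPart A + symPart A' := by
  refine Subtype.ext (Matrix.ext fun i j => ?_)
  simp only [AddSubgroup.coe_add, Matrix.add_apply, symPart_apply, add_apply, inner_add_left]
  ring

theorem symPart_smul (c : ℝ) (A : EuclideanSpace ℝ (Fin n) →L[ℝ] EuclideanSpace ℝ (Fin n)) :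
    symPart (c • A) = c • symPart A := by
  refine Subtype.ext (Matrix.ext fun i j => ?_)
  simp only [selfAdjoint.val_smul, Matrix.smul_apply, symPart_apply, smul_apply,
    real_inner_smul_left, smul_eq_mul]
  ring

/-- Symmetrizing leaves the quadratic form unchanged, so A itself need not be symmetric, as is
convenient for pointwise derivatives of gradients. -/
theorem posDef_symPart {A : EuclideanSpace ℝ (Fin n) →L[ℝ] EuclideanSpace ℝ (Fin n)}
    (hA : ∀ h, h ≠ 0 → 0 < (inner ℝ (A h) h : ℝ)) :
    (symPart A : Matrix (Fin n) (Fin n) ℝ).PosDef := by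
  refine Matrix.PosDef.of_dotProduct_mulVec_pos (symPart A).2 fun w hw => ?_
  have hw' : WithLp.toLp 2 w ≠ 0 := by simpa using hw
  refine (hA _ hw').trans_le (le_of_eq ?_)
  have hexp : WithLp.toLp 2 w = ∑ i, w i • EuclideanSpace.single i (1 : ℝ) := by
    ext j
    simp [Finset.sum_apply, Pi.single_apply]
  have h1 : inner ℝ (A (WithLp.toLp 2 w)) (WithLp.toLp 2 w) =
      ∑ i, ∑ j, w i * w j *
        inner ℝ (A (EuclideanSpace.single i (1 : ℝ))) (EuclideanSpace.single j 1) := by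
    rw [hexp, map_sum, sum_inner]
    refine Finset.sum_congr rfl fun i _ => ?_
    rw [inner_sum]
    refine Finset.sum_congr rfl fun j _ => ?_
    rw [map_smul, real_inner_smul_left, real_inner_smul_right]
    ring
  have h2 : star w ⬝ᵥ (symPart A : Matrix (Fin n) (Fin n) ℝ).mulVec w =
      (∑ i, ∑ j, w i * w j *
        inner ℝ (A (EuclideanSpace.single i (1 : ℝ))) (EuclideanSpace.single j 1)) / 2 +
      (∑ i, ∑ j, w i * w j *
        inner ℝ (A (EuclideanSpace.single j (1 : ℝ))) (EuclideanSpace.single i 1)) / 2 := by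
    simp only [dotProduct, Matrix.mulVec, symPart_apply, Finset.mul_sum, Finset.sum_div,
      ← Finset.sum_add_distrib, Pi.star_apply, star_trivial]
    refine Finset.sum_congr rfl fun i _ => Finset.sum_congr rfl fun j _ => ?_
    ring
  have h3 : (∑ i, ∑ j, w i * w j *
        inner ℝ (A (EuclideanSpace.single j (1 : ℝ))) (EuclideanSpace.single i 1)) =
      ∑ i, ∑ j, w i * w j *
        inner ℝ (A (EuclideanSpace.single i (1 : ℝ))) (EuclideanSpace.single j 1) := by
    rw [Finset.sum_comm]
    refine Finset.sum_congr rfl fun i _ => Finset.sum_congr rfl fun j _ => ?_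
    ring
  rw [h2, h3, h1]
  ring

theorem hasFDerivAt_quadPoly_sub
    (r : ℝ) (p x : EuclideanSpace ℝ (Fin n))
    (A : EuclideanSpace ℝ (Fin n) →L[ℝ] EuclideanSpace ℝ (Fin n))
    (y : EuclideanSpace ℝ (Fin n)) :
    HasFDerivAt (fun y => quadPoly r p A (y - x))
      (innerSL ℝ p + (1 / 2 : ℝ) • (innerSL ℝ (A (y - x)) + (innerSL ℝ (y - x)).comp A)) y := by
  have h1 : HasFDerivAt (fun y => y - x)
      (ContinuousLinearMap.id ℝ (EuclideanSpace ℝ (Fin n))) y := (hasFDerivAt_id y).sub_const x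
  have h2 := (((hasFDerivAt_const p y).inner ℝ h1).const_add r).add
    (((A.hasFDerivAt.comp y h1).inner ℝ h1).const_mul (1 / 2 : ℝ))
  refine h2.congr_fderiv ?_
  ext h
  simp [real_inner_comm, inner_sub_left, inner_sub_right]
  ring

theorem contDiff_quadPoly_sub
    (r : ℝ) (p x : EuclideanSpace ℝ (Fin n))
    (A : EuclideanSpace ℝ (Fin n) →L[ℝ] EuclideanSpace ℝ (Fin n)) :
    ContDiff ℝ 2 (fun y => quadPoly r p A (y - x)) := by
  unfold quadPoly
  have h1 : ContDiff ℝ 2 (fun y : EuclideanSpace ℝ (Fin n) => y - x) := by fun_prop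
  exact ((contDiff_const.add (contDiff_const.inner ℝ h1)).add
    (contDiff_const.mul ((A.contDiff.comp h1).inner ℝ h1)))

theorem jet2_quadPoly_sub (r : ℝ) (p x : EuclideanSpace ℝ (Fin n))
    (A : EuclideanSpace ℝ (Fin n) →L[ℝ] EuclideanSpace ℝ (Fin n))
    (hφ : ContDiffAt ℝ 2 (fun y => quadPoly r p A (y - x)) x) :
    jet2 (fun y => quadPoly r p A (y - x)) x hφ = (r, p, symPart A) := by
  refine Prod.ext ?_ (Prod.ext ?_ (Subtype.ext (Matrix.ext fun i j => ?_)))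
  · simp [jet2, quadPoly_zero]
  · have h1 : HasGradientAt (fun y => quadPoly r p A (y - x)) p x := by
      rw [hasGradientAt_iff_hasFDerivAt]
      refine (hasFDerivAt_quadPoly_sub r p x A x).congr_fderiv ?_
      ext h
      simp
    exact h1.gradient
  · have h1 : fderiv ℝ (fun y => quadPoly r p A (y - x)) = fun y =>
        innerSL ℝ p + (1 / 2 : ℝ) • (innerSL ℝ (A (y - x)) + (innerSL ℝ (y - x)).comp A) :=
      funext fun y => (hasFDerivAt_quadPoly_sub r p x A y).fderiv
    have hd : DifferentiableAt ℝ (fderiv ℝ (fun y => quadPoly r p A (y - x))) x :=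
      (hφ.fderiv_right (m := 1) (by norm_num)).differentiableAt (by norm_num)
    set e := EuclideanSpace.single i (1 : ℝ)
    set e' := EuclideanSpace.single j (1 : ℝ)
    have h2 : HasFDerivAt (fun y => fderiv ℝ (fun y => quadPoly r p A (y - x)) y e')
        ((ContinuousLinearMap.apply ℝ ℝ e').comp
          (fderiv ℝ (fderiv ℝ (fun y => quadPoly r p A (y - x))) x)) x :=
      (ContinuousLinearMap.apply ℝ ℝ e').hasFDerivAt.comp x hd.hasFDerivAt
    have hs : HasFDerivAt (fun y => y - x)
        (ContinuousLinearMap.id ℝ (EuclideanSpace ℝ (Fin n))) x := (hasFDerivAt_id x).sub_const x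
    have h3 := ((((A.hasFDerivAt.comp x hs).inner ℝ (hasFDerivAt_const e' x)).add
      (hs.inner ℝ (hasFDerivAt_const (A e') x))).const_mul (1 / 2 : ℝ)).const_add (inner ℝ p e')
    have h4 : (fun y => fderiv ℝ (fun y => quadPoly r p A (y - x)) y e') = fun y =>
        inner ℝ p e' + 1 / 2 * (inner ℝ (A (y - x)) e' + inner ℝ (y - x) (A e')) := by
      funext y
      rw [h1]
      simp [inner_sub_left]
      ring
    rw [h4] at h2
    have h5 := DFunLike.congr_fun (h2.unique h3) e
    change fderiv ℝ (fderiv ℝ (fun y => quadPoly r p A (y - x))) x e e' = _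
    rw [symPart_apply]
    simp only [ContinuousLinearMap.comp_apply, ContinuousLinearMap.apply_apply] at h5
    rw [h5]
    simp [e, e', real_inner_comm]
    ring

end PotentialTheory

/-! ### From upper jets to membership in F + G -/

namespace PotentialTheory

variable {n : ℕ}

theorem tendsto_add_smul_symMat (S S' : SymMat n) (c : ℝ) :
    Filter.Tendsto (fun ε : ℝ => S + (c * ε) • S') (𝓝 0) (𝓝 S) := by
  have h1 : Continuous fun ε : ℝ => S + (c * ε) • S' := by
    refine continuous_induced_rng.2 ?_
    change Continuous fun ε : ℝ => (S : Matrix (Fin n) (Fin n) ℝ) + (c * ε) • (S' : Matrix _ _ ℝ)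
    fun_prop
  simpa using h1.tendsto 0

/-- Upper contact jets in the sense of Peano are limits of jets of upper test functions. -/
theorem mem_of_hasUpperJet {F : Set (Jet2 n)} (hF : IsClosed F)
    {u : EuclideanSpace ℝ (Fin n) → EReal} {w : EuclideanSpace ℝ (Fin n) → ℝ}
    {x₀ a p : EuclideanSpace ℝ (Fin n)}
    {A : EuclideanSpace ℝ (Fin n) →L[ℝ] EuclideanSpace ℝ (Fin n)}
    (hu : IsSubharmonicAt F u (x₀ + a)) (hle : ∀ᶠ y in 𝓝 a, u (x₀ + y) ≤ (w y : EReal))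
    (heq : u (x₀ + a) = (w a : EReal)) (hw : HasUpperJet w a p A) :
    (w a, p, symPart A) ∈ F := by
  -- Adding ε‖y - a‖² absorbs the Peano error and gives a genuine test function; its Hessian is 2εI.
  have key : ∀ ε : ℝ, ε > 0 → (w a, p, symPart A + (2 * ε) •
      symPart (ContinuousLinearMap.id ℝ (EuclideanSpace ℝ (Fin n)))) ∈ F := by
    intro ε hε
    rw [← symPart_smul, ← symPart_add]
    have hC := (contDiff_quadPoly_sub (w a) p (x₀ + a)
      (A + (2 * ε) • ContinuousLinearMap.id ℝ _)).contDiffAt (x := x₀ + a)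
    rw [← jet2_quadPoly_sub (w a) p (x₀ + a) _ hC]
    refine hu _ hC ?_ ?_
    · have ht : Filter.Tendsto (fun y => y - x₀) (𝓝 (x₀ + a)) (𝓝 a) := by
        have : Filter.Tendsto (fun y => y - x₀) (𝓝 (x₀ + a)) (𝓝 (x₀ + a - x₀)) :=
          Continuous.tendsto (by fun_prop) _
        rwa [add_sub_cancel_left] at this
      filter_upwards [ht.eventually hle, ht.eventually (hw ε hε)] with y h1 h2
      rw [add_sub_cancel] at h1
      refine h1.trans (EReal.coe_le_coe_iff.2 (h2.trans (le_of_eq ?_)))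
      rw [sub_sub]
      simp only [quadPoly, add_apply, smul_apply, ContinuousLinearMap.id_apply, inner_add_left,
        real_inner_smul_left, real_inner_self_eq_norm_sq]
      ring
    · rw [heq, sub_self, quadPoly_zero]
  have hlim : Filter.Tendsto (fun ε : ℝ => ((w a, p, symPart A + (2 * ε) •
      symPart (ContinuousLinearMap.id ℝ (EuclideanSpace ℝ (Fin n)))) : Jet2 n)) (𝓝[>] 0)
      (𝓝 (w a, p, symPart A)) :=
    tendsto_const_nhds.prodMk_nhds (tendsto_const_nhds.prodMk_nhds
      ((tendsto_add_smul_symMat _ _ 2).mono_left nhdsWithin_le_nhds))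
  exact hF.mem_of_tendsto hlim (by filter_upwards [self_mem_nhdsWithin] with ε hε using key ε hε)

/-- The Riesz isomorphism from the dual, as a continuous linear map. -/
noncomputable def rieszMap (n : ℕ) :
    (EuclideanSpace ℝ (Fin n) →L[ℝ] ℝ) →L[ℝ] EuclideanSpace ℝ (Fin n) :=
  LinearMap.toContinuousLinearMap
    { toFun := fun f => (InnerProductSpace.toDual ℝ _).symm f
      map_add' := fun f g => map_add _ f g
      map_smul' := fun c f => by simp }

theorem inner_rieszMap (f : EuclideanSpace ℝ (Fin n) →L[ℝ] ℝ) (h : EuclideanSpace ℝ (Fin n)) :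
    inner ℝ (rieszMap n f) h = f h :=
  InnerProductSpace.toDual_symm_apply

/-- Through Riesz, the second Fréchet derivative becomes the derivative L of the gradient, to which
the Peano expansion applies. -/
theorem exists_taylor_of_contDiffAt {φ : EuclideanSpace ℝ (Fin n) → ℝ}
    {x : EuclideanSpace ℝ (Fin n)} (hφ : ContDiffAt ℝ 2 φ x) :
    ∃ L : EuclideanSpace ℝ (Fin n) →L[ℝ] EuclideanSpace ℝ (Fin n),
      (∀ h k, inner ℝ (L h) k = inner ℝ (L k) h) ∧
      jet2 φ x hφ = (φ x, gradient φ x, symPart L) ∧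
      ∀ ε > 0, ∀ᶠ y in 𝓝 x, φ y ≤ quadPoly (φ x) (gradient φ x) L (y - x) +
        ε * ‖y - x‖ ^ 2 := by
  have hsymm : IsSymmSndFDerivAt ℝ φ x := hφ.isSymmSndFDerivAt (by simp)
  have hin : ∀ h k, inner ℝ ((rieszMap n).comp (fderiv ℝ (fderiv ℝ φ) x) h) k =
      fderiv ℝ (fderiv ℝ φ) x h k := fun h k => inner_rieszMap _ _
  refine ⟨(rieszMap n).comp (fderiv ℝ (fderiv ℝ φ) x), fun h k => ?_, ?_, fun ε hε => ?_⟩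
  · rw [hin, hin, hsymm.eq]
  · refine Prod.ext rfl (Prod.ext rfl (Subtype.ext (Matrix.ext fun i j => ?_)))
    rw [symPart_apply, hin, hin, hsymm.eq (EuclideanSpace.single j 1), add_self_div_two]
    rfl
  · have hd : DifferentiableAt ℝ (fderiv ℝ φ) x :=
      (hφ.fderiv_right (m := 1) (by norm_num)).differentiableAt (by norm_num)
    have h1 : HasFDerivAt (gradient φ) ((rieszMap n).comp (fderiv ℝ (fderiv ℝ φ) x)) x :=
      (rieszMap n).hasFDerivAt.comp x hd.hasFDerivAt
    have h2 : ∀ᶠ y in 𝓝 x, HasFDerivAt φ (innerSL ℝ (gradient φ y)) y := by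
      filter_upwards [hφ.eventually (by simp)] with y hy
      exact (hy.differentiableAt (by norm_num)).hasGradientAt.hasFDerivAt
    filter_upwards [eventually_abs_sub_taylor_le h2 h1 hε] with y hy
    have := (abs_le.1 hy).2
    unfold quadPoly
    linarith

/-- Truncation from below of an extended real number. -/
noncomputable def truncBelow (k : ℝ) (z : EReal) : ℝ := (max z ((-k : ℝ) : EReal)).toReal

theorem coe_truncBelow (k : ℝ) {z : EReal} (hz : z ≠ ⊤) :
    (truncBelow k z : EReal) = max z ((-k : ℝ) : EReal) := by
  refine EReal.coe_toReal ?_ ?_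
  · rcases max_choice z ((-k : ℝ) : EReal) with h | h <;> rw [h]
    · exact hz
    · exact EReal.coe_ne_top _
  · exact ((EReal.bot_lt_coe (-k)).trans_le (le_max_right _ _)).ne'

theorem le_truncBelow (k : ℝ) {z : EReal} (hz : z ≠ ⊤) : z ≤ (truncBelow k z : EReal) := by
  rw [coe_truncBelow k hz]
  exact le_max_left _ _

theorem truncBelow_eq_or (k : ℝ) {z : EReal} (hz : z ≠ ⊤) :
    truncBelow k z = -k ∨ z = (truncBelow k z : EReal) := by
  rw [← EReal.coe_eq_coe_iff, coe_truncBelow k hz]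
  exact (max_choice z ((-k : ℝ) : EReal)).symm.imp id Eq.symm

theorem truncBelow_le {k C : ℝ} {z : EReal} (hz : z ≤ (C : EReal)) (hC : -k ≤ C) :
    truncBelow k z ≤ C := by
  rw [← EReal.coe_le_coe_iff, coe_truncBelow k (hz.trans_lt (EReal.coe_lt_top C)).ne]
  exact max_le hz (EReal.coe_le_coe_iff.2 hC)

/-- Either truncation is inactive in both terms, or one term is -k and the sum is at most -k + C. -/
theorem truncBelow_add_le {k C s : ℝ} {z z' : EReal} (hz : z ≤ (C : EReal))
    (hz' : z' ≤ (C : EReal)) (hC : -k ≤ C) (hs : -k + C ≤ s) (h : z + z' ≤ (s : EReal)) :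
    truncBelow k z + truncBelow k z' ≤ s := by
  have h1 := truncBelow_le hz hC
  have h2 := truncBelow_le hz' hC
  rcases truncBelow_eq_or k (hz.trans_lt (EReal.coe_lt_top C)).ne with h3 | h3
  · linarith
  rcases truncBelow_eq_or k (hz'.trans_lt (EReal.coe_lt_top C)).ne with h4 | h4
  · linarith
  rw [h3, h4, ← EReal.coe_add, EReal.coe_le_coe_iff] at h
  exact h

theorem upperSemicontinuousOn_truncBelow {u : EuclideanSpace ℝ (Fin n) → EReal}
    {X S : Set (EuclideanSpace ℝ (Fin n))} {x₀ : EuclideanSpace ℝ (Fin n)} (hu : IsUSC X u)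
    (hS : ∀ h ∈ S, x₀ + h ∈ X) (k : ℝ) :
    UpperSemicontinuousOn (fun h => truncBelow k (u (x₀ + h))) S := by
  intro h hh y hy
  rw [← EReal.coe_lt_coe_iff, coe_truncBelow k (hu.2 _ (hS h hh)), max_lt_iff] at hy
  have ht : Filter.Tendsto (fun h => x₀ + h) (𝓝[S] h) (𝓝[X] (x₀ + h)) :=
    tendsto_nhdsWithin_iff.2 ⟨(Continuous.tendsto (by fun_prop) h).mono_left nhdsWithin_le_nhds,
      by filter_upwards [self_mem_nhdsWithin] with z hz using hS z hz⟩
  filter_upwards [ht.eventually (hu.1 _ (hS h hh) y hy.1), self_mem_nhdsWithin] with z hz hzS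
  rw [← EReal.coe_lt_coe_iff, coe_truncBelow k (hu.2 _ (hS z hzS))]
  exact max_lt hz hy.2

theorem isUSC_add {X : Set (EuclideanSpace ℝ (Fin n))} {u v : EuclideanSpace ℝ (Fin n) → EReal}
    (hu : IsUSC X u) (hv : IsUSC X v) : IsUSC X (u + v) :=
  ⟨hu.1.add' hv.1 fun x hx => EReal.continuousAt_add (.inl (hu.2 x hx)) (.inr (hv.2 x hx)),
    fun x hx => EReal.add_ne_top (hu.2 x hx) (hv.2 x hx)⟩

/-- Jets of upper test functions of a sum are approximated by sums of jets in `F` and `G`. -/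
theorem exists_mem_add_near_jet {F G : Set (Jet2 n)} (hF : IsConstCoeffSubequation F)
    (hG : IsConstCoeffSubequation G) {X : Set (EuclideanSpace ℝ (Fin n))} (hX : IsOpen X)
    {u v : EuclideanSpace ℝ (Fin n) → EReal} (hu : u ∈ subharmonics F X)
    (hv : v ∈ subharmonics G X) {x₀ : EuclideanSpace ℝ (Fin n)} (hx₀ : x₀ ∈ X)
    {φ : EuclideanSpace ℝ (Fin n) → ℝ} (hφ : ContinuousAt φ x₀)
    (hle : ∀ᶠ y in 𝓝 x₀, (u + v) y ≤ (φ y : EReal)) (heq : (u + v) x₀ = (φ x₀ : EReal))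
    {p₀ : EuclideanSpace ℝ (Fin n)}
    {L : EuclideanSpace ℝ (Fin n) →L[ℝ] EuclideanSpace ℝ (Fin n)}
    (hL : ∀ h k, inner ℝ (L h) k = inner ℝ (L k) h)
    (htay : ∀ ε > 0, ∀ᶠ y in 𝓝 x₀, φ y ≤ quadPoly (φ x₀) p₀ L (y - x₀) + ε * ‖y - x₀‖ ^ 2)
    {ε : ℝ} (hε : 0 < ε) (hε1 : ε ≤ 1) :
    ∃ (s : ℝ) (p : EuclideanSpace ℝ (Fin n)), |s - φ x₀| < ε ∧ ‖p - p₀‖ < ε ∧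
      (s, p, symPart L + (5 * ε) •
        symPart (ContinuousLinearMap.id ℝ (EuclideanSpace ℝ (Fin n)))) ∈ F + G := by
  set r := φ x₀ with hr
  have hcF : IsClosed F := by rw [hF.topological]; exact isClosed_closure
  have hcG : IsClosed G := by rw [hG.topological]; exact isClosed_closure
  -- a common real upper bound for `u` and `v` near `x₀`
  have hbd : ∀ {w : EuclideanSpace ℝ (Fin n) → EReal}, IsUSC X w →
      ∃ C : ℝ, ∀ᶠ y in 𝓝 x₀, w y ≤ (C : EReal) := by
    intro w hw
    obtain ⟨C, hC, -⟩ := EReal.lt_iff_exists_real_btwn.1 (lt_top_iff_ne_top.2 (hw.2 x₀ hx₀))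
    refine ⟨C, ?_⟩
    have := hw.1 x₀ hx₀ C hC
    rw [hX.nhdsWithin_eq hx₀] at this
    exact this.mono fun y hy => hy.le
  obtain ⟨C₁, hC₁⟩ := hbd hu.1
  obtain ⟨C₂, hC₂⟩ := hbd hv.1
  set C := max C₁ C₂ with hCdef
  -- The floor is so low that a truncated term forces the sum below r - 2, well under φ near x₀.
  set k := |C| + |r| + 2 with hk
  have hkC : -k ≤ C := by linarith [neg_abs_le C, abs_nonneg r]
  have hkr : -k + C ≤ r - 2 := by linarith [le_abs_self C, neg_abs_le r]
  have hφ1 : ∀ᶠ y in 𝓝 x₀, r - 1 < φ y := hφ.eventually (lt_mem_nhds (by linarith))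
  obtain ⟨ρ₀, hρ₀, hball⟩ := Metric.eventually_nhds_iff_ball.1
    ((hX.eventually_mem hx₀).and (hC₁.and (hC₂.and (hle.and (hφ1.and (htay ε hε))))))
  set ρ := ρ₀ / 2 with hρdef
  have hρ : 0 < ρ := by positivity
  have hmem : ∀ h ∈ Metric.closedBall (0 : EuclideanSpace ℝ (Fin n)) ρ,
      x₀ + h ∈ Metric.ball x₀ ρ₀ := by
    intro h hh
    rw [mem_closedBall_zero_iff] at hh
    rw [Metric.mem_ball, dist_eq_norm, add_sub_cancel_left]
    linarith
  have hXm : ∀ h ∈ Metric.closedBall (0 : EuclideanSpace ℝ (Fin n)) ρ, x₀ + h ∈ X :=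
    fun h hh => (hball _ (hmem h hh)).1
  have huC : ∀ h ∈ Metric.closedBall (0 : EuclideanSpace ℝ (Fin n)) ρ, u (x₀ + h) ≤ (C : EReal) :=
    fun h hh => (hball _ (hmem h hh)).2.1.trans (EReal.coe_le_coe_iff.2 (le_max_left _ _))
  have hvC : ∀ h ∈ Metric.closedBall (0 : EuclideanSpace ℝ (Fin n)) ρ, v (x₀ + h) ≤ (C : EReal) :=
    fun h hh => (hball _ (hmem h hh)).2.2.1.trans (EReal.coe_le_coe_iff.2 (le_max_right _ _))
  have h0mem : (0 : EuclideanSpace ℝ (Fin n)) ∈ Metric.closedBall 0 ρ := by simp [hρ.le]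
  let U : EuclideanSpace ℝ (Fin n) → ℝ := fun h => truncBelow k (u (x₀ + h))
  let V : EuclideanSpace ℝ (Fin n) → ℝ := fun h => truncBelow k (v (x₀ + h))
  have hU : UpperSemicontinuousOn U (Metric.closedBall 0 ρ) :=
    upperSemicontinuousOn_truncBelow hu.1 hXm k
  have hV : UpperSemicontinuousOn V (Metric.closedBall 0 ρ) :=
    upperSemicontinuousOn_truncBelow hv.1 hXm k
  have hUC : ∀ h ∈ Metric.closedBall (0 : EuclideanSpace ℝ (Fin n)) ρ, U h ≤ C :=
    fun h hh => truncBelow_le (huC h hh) hkC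
  have hVC : ∀ h ∈ Metric.closedBall (0 : EuclideanSpace ℝ (Fin n)) ρ, V h ≤ C :=
    fun h hh => truncBelow_le (hvC h hh) hkC
  have hUV : ∀ h ∈ Metric.closedBall (0 : EuclideanSpace ℝ (Fin n)) ρ, U h + V h ≤ φ (x₀ + h) := by
    intro h hh
    obtain ⟨-, -, -, h1, h2, -⟩ := hball _ (hmem h hh)
    exact truncBelow_add_le (huC h hh) (hvC h hh) hkC (by linarith) h1
  have hUV0 : U 0 + V 0 = r := by
    refine le_antisymm (by simpa using hUV 0 h0mem) ?_
    rw [← EReal.coe_le_coe_iff, ← heq, EReal.coe_add]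
    have h1 := le_truncBelow k (hu.1.2 _ (hXm 0 h0mem))
    have h2 := le_truncBelow k (hv.1.2 _ (hXm 0 h0mem))
    simpa [U, V] using add_le_add h1 h2
  set I := ContinuousLinearMap.id ℝ (EuclideanSpace ℝ (Fin n)) with hI
  -- The term 4εI adds 2ε‖h‖²: one ε pays the Taylor error, the other makes the contact strict.
  have hquad : ∀ h ∈ Metric.closedBall (0 : EuclideanSpace ℝ (Fin n)) ρ,
      U h + V h ≤ quadPoly r p₀ (L + (4 * ε) • I) h - ε * ‖h‖ ^ 2 := by
    intro h hh
    obtain ⟨-, -, -, -, -, h1⟩ := hball _ (hmem h hh)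
    rw [add_sub_cancel_left] at h1
    refine (hUV h hh).trans (h1.trans (le_of_eq ?_))
    simp only [quadPoly, hI, add_apply, smul_apply, ContinuousLinearMap.id_apply, inner_add_left,
      real_inner_smul_left, real_inner_self_eq_norm_sq]
    ring
  have hL' : ∀ h k, inner ℝ ((L + (4 * ε) • I) h) k = inner ℝ ((L + (4 * ε) • I) k) h := by
    intro h k
    simp only [hI, add_apply, smul_apply, ContinuousLinearMap.id_apply, inner_add_left,
      real_inner_smul_left, hL h k, real_inner_comm h k]
  -- upper semicontinuity at the contact point
  have hnear : ∀ {w : EuclideanSpace ℝ (Fin n) → ℝ},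
      UpperSemicontinuousOn w (Metric.closedBall 0 ρ) →
      ∀ᶠ h in 𝓝 0, w h < w 0 + ε / 2 := by
    intro w hw
    have := hw 0 h0mem (w 0 + ε / 2) (by linarith)
    rwa [nhdsWithin_eq_nhds.2 (Metric.closedBall_mem_nhds _ hρ)] at this
  obtain ⟨σ, hσ, hσball⟩ := Metric.eventually_nhds_iff_ball.1 ((hnear hU).and (hnear hV))
  have hη : 0 < min ε (min σ ρ) := by positivity
  obtain ⟨a, ha, b, hb, p₁, p₂, A₁, A₂, hj₁, hj₂, hp, hA, hlow⟩ :=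
    exists_hasUpperJet_of_add_le_quadPoly hL' hρ hU hV hε hquad hUV0 hη
  have m1 : min ε (min σ ρ) ≤ ε := min_le_left _ _
  have m2 : min ε (min σ ρ) ≤ σ := (min_le_right _ _).trans (min_le_left _ _)
  have m3 : min ε (min σ ρ) ≤ ρ := (min_le_right _ _).trans (min_le_right _ _)
  have haρ := Metric.ball_subset_ball m3 ha
  have hbρ := Metric.ball_subset_ball m3 hb
  have haB := Metric.ball_subset_closedBall haρ
  have hbB := Metric.ball_subset_closedBall hbρ
  -- Truncation is inactive here, since U a + V b > r - ε ≥ r - 1; this is where ε ≤ 1 matters.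
  have hua : u (x₀ + a) = (U a : EReal) := by
    rcases truncBelow_eq_or k (hu.1.2 _ (hXm a haB)) with h | h
    · have h1 : U a = -k := h
      have h2 := hVC b hbB
      linarith
    · exact h
  have hvb : v (x₀ + b) = (V b : EReal) := by
    rcases truncBelow_eq_or k (hv.1.2 _ (hXm b hbB)) with h | h
    · have h1 : V b = -k := h
      have h2 := hUC a haB
      linarith
    · exact h
  have hJ₁ : (U a, p₁, symPart A₁) ∈ F := by
    refine mem_of_hasUpperJet hcF (hu.2 _ (hXm a haB)) ?_ hua hj₁
    filter_upwards [Metric.isOpen_ball.mem_nhds haρ] with y hy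
    exact le_truncBelow k (hu.1.2 _ (hXm y (Metric.ball_subset_closedBall hy)))
  have hJ₂ : (V b, p₂, symPart A₂) ∈ G := by
    refine mem_of_hasUpperJet hcG (hv.2 _ (hXm b hbB)) ?_ hvb hj₂
    filter_upwards [Metric.isOpen_ball.mem_nhds hbρ] with y hy
    exact le_truncBelow k (hv.1.2 _ (hXm y (Metric.ball_subset_closedBall hy)))
  -- The fifth ε upgrades A₁ + A₂ ≤ L + 4εI to the strict inequality that positivity requires.
  have hP : (symPart (L + (5 * ε) • I + (-1 : ℝ) • A₁ + (-1 : ℝ) • A₂) :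
      Matrix (Fin n) (Fin n) ℝ).PosDef := by
    refine posDef_symPart fun h hh => ?_
    have h1 := hA h
    have h2 : 0 < ε * ‖h‖ ^ 2 := by
      have := norm_pos_iff.2 hh
      positivity
    simp only [hI, add_apply, smul_apply, ContinuousLinearMap.id_apply, inner_add_left,
      real_inner_smul_left, real_inner_self_eq_norm_sq] at h1 ⊢
    linarith
  have hJ₁' := hF.positivity _ _ _ _ hJ₁ hP
  refine ⟨U a + V b, p₁ + p₂, ?_, hp.trans_le m1, ?_⟩
  -- Semicontinuity at the origin bounds the sum of values from above, and `hlow` from below.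
  · have h1 := (hσball a (Metric.ball_subset_ball m2 ha)).1
    have h2 := (hσball b (Metric.ball_subset_ball m2 hb)).2
    rw [abs_lt]
    constructor <;> linarith
  · refine Set.mem_add.2 ⟨_, hJ₁', _, hJ₂, ?_⟩
    refine Prod.ext rfl (Prod.ext rfl ?_)
    simp only [Prod.snd_add, symPart_add, symPart_smul]
    module

end PotentialTheory

/-! ### Passage to the limit in H -/

theorem mainTheorem7 {n : ℕ} (F G H : Set (PotentialTheory.Jet2 n))
    (hF : PotentialTheory.IsConstCoeffSubequation F)
    (hG : PotentialTheory.IsConstCoeffSubequation G)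
    (hH : IsClosed H) (hFG : F + G ⊆ H)
    (X : Set (EuclideanSpace ℝ (Fin n))) (hX : IsOpen X) :
    PotentialTheory.subharmonics F X + PotentialTheory.subharmonics G X ⊆
      PotentialTheory.subharmonics H X := by
  open PotentialTheory in
  rintro _ ⟨u, hu, v, hv, rfl⟩
  refine ⟨isUSC_add hu.1 hv.1, fun x₀ hx₀ φ hφ hle heq => ?_⟩
  obtain ⟨L, hL, hjet, htay⟩ := exists_taylor_of_contDiffAt hφ
  rw [hjet]
  have hpos : ∀ k : ℕ, (0 : ℝ) < 1 / ((k : ℝ) + 1) := fun k => by positivity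
  have hle1 : ∀ k : ℕ, 1 / ((k : ℝ) + 1) ≤ 1 := fun k => by
    rw [div_le_one (by positivity)]
    simp
  choose s p hs hp hmem using fun k : ℕ => exists_mem_add_near_jet hF hG hX hu hv hx₀
    hφ.continuousAt hle heq hL htay (hpos k) (hle1 k)
  have hlim := tendsto_one_div_add_atTop_nhds_zero_nat (𝕜 := ℝ)
  have ls : Filter.Tendsto s Filter.atTop (𝓝 (φ x₀)) :=
    tendsto_iff_dist_tendsto_zero.2 (squeeze_zero (fun _ => dist_nonneg) (fun k => (hs k).le) hlim)
  have lp : Filter.Tendsto p Filter.atTop (𝓝 (gradient φ x₀)) :=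
    tendsto_iff_norm_sub_tendsto_zero.2
      (squeeze_zero (fun _ => norm_nonneg _) (fun k => (hp k).le) hlim)
  have lA : Filter.Tendsto (fun k : ℕ => symPart L + (5 * (1 / ((k : ℝ) + 1))) •
      symPart (ContinuousLinearMap.id ℝ (EuclideanSpace ℝ (Fin n)))) Filter.atTop
      (𝓝 (symPart L)) := (tendsto_add_smul_symMat _ _ 5).comp hlim
  exact hH.mem_of_tendsto (ls.prodMk_nhds (lp.prodMk_nhds lA))
    (Filter.Eventually.of_forall fun k => hFG (hmem k))
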